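/- Let $n\ge 0$, $R=\mathbf Z[\mathbf Z^n]$, $\mathcal L=R((t))=R[[t]][t^{-1}]$. A free complex over a commutative ring $A$ is a chain complex $C_*=\{0\leftarrow C_0\leftarrow C_1\leftarrow\dots\leftarrow C_N\leftarrow 0\}$ of finitely generated free $A$-modules; its Morse number $\mathcal M_A(C_*)$ is the minimal total rank $\sum_i \operatorname{rk} D_i$ of a free complex $D_*$ over $A$ chain homotopy equivalent to $C_*$. For a free $R[[t]]$-complex $D_*$ and $k\in\mathbf N$ put $\mu_k(D_*)=\mathcal M_R(D_*/t^kD_*)$. A basic subcomplex of a free $\mathcal L$-complex $C_*$ is a subcomplex $D_*\subset C_*$ which is a free $R[[t]]$-complex and satisfies $D_*[t^{-1}]=C_*$. The complex $C_*$ is of asymptotically linear growth if for some basic subcomplex $D_*$ there are real constants $\alpha, K$ with $\alpha k-K\le\mu_k(D_*)\le\alpha k+K$ for all $k\in\mathbf N$. The number $s(C_*)$ is $\lim_{k\to\infty}\mu_k(D_*)/k$, where $D_*$ is any basic subcomplex (part of the claim below is that basic subcomplexes exist, and that the limit exists and has the stated value for each of them). Let $Z=z_kt^k+\dots+z_lt^l\in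 R[t,t^{-1}]$ with $k\le l$ and $z_k,z_l\ne0$. Call $Z$ monic if its lowest coefficient $z_k$ is $\pm g$ with $g\in\mathbf Z^n$; numerically prime if it is not divisible by any integer other than $\pm1$; special if each coefficient $z_i$ is of the form $ag$ with $a\in\mathbf Z$, $g\in\mathbf Z^n$. A free $\mathcal L$-complex $C_*$ is of principal type if for every $i$ an isomorphism $$H_i(C_*)\cong\Big(\bigoplus_{j=1}^{b_i}\mathcal L\Big)\oplus\Big(\bigoplus_{s=1}^{q_i}\mathcal L/a_s^{(i)}\mathcal L\Big)$$ is fixed, where each $a_s^{(i)}\in R[t,t^{-1}]$ is special, non-zero and not monic, and $a_s^{(i)}\mid a_{s+1}^{(i)}$ in $\mathcal L$. Let $\kappa_i$ be the number of those $s\in\{1,\dots,q_i\}$ for which $a_s^{(i)}$ is not numerically prime. **Theorem.** Let $C_*$ be a free $\mathcal L$-complex of principal type. Then $C_*$ is of asymptotically linear growth, and $$s(C_*)=\sum_i b_i+2\sum_i\kappa_i .$$ -/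

import Mathlib

open CategoryTheory Filter Topology
open scoped PowerSeries LaurentSeries LaurentPolynomial

noncomputable section

namespace MorseGrowth

/-! ### Rings -/

/-- The group ring `R = ℤ[ℤⁿ]`. -/
abbrev GroupRing (n : ℕ) : Type := AddMonoidAlgebra ℤ (Fin n → ℤ)

/-- The ring `𝓛 = R((t))` of formal Laurent series over `R = ℤ[ℤⁿ]`. -/
abbrev LaurentRing (n : ℕ) : Type := LaurentSeries (GroupRing n)

/-- The inclusion `R[t, t⁻¹] ⊂ R((t))`: the Laurent series with the same coefficients. -/
def toLaurentSeries {n : ℕ} (z : LaurentPolynomial (GroupRing n)) : LaurentRing n :=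
  HahnSeries.ofFinsupp z.coeff

/-! ### Laurent polynomials over `ℤ[ℤⁿ]` -/

/-- A monomial of `R = ℤ[ℤⁿ]` is an element `a g` with `a ∈ ℤ`, `g ∈ ℤⁿ`. -/
def IsMonomial {n : ℕ} (x : GroupRing n) : Prop :=
  ∃ (g : Fin n → ℤ) (a : ℤ), x = AddMonoidAlgebra.single g a

/-- `z = z_k t^k + ⋯ + z_l t^l` is special if each coefficient `z_i` is a monomial of `R`. -/
def IsSpecial {n : ℕ} (z : LaurentPolynomial (GroupRing n)) : Prop :=
  ∀ i : ℤ, IsMonomial (z.coeff i)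

/-- `z` is monic if its lowest non-zero coefficient is `± g` with `g ∈ ℤⁿ`. -/
def IsMonic {n : ℕ} (z : LaurentPolynomial (GroupRing n)) : Prop :=
  ∃ (k : ℤ) (g : Fin n → ℤ), (∀ j < k, z.coeff j = 0) ∧
    (z.coeff k = AddMonoidAlgebra.single g 1 ∨ z.coeff k = AddMonoidAlgebra.single g (-1))

/-- `z` is numerically prime if the only integers dividing it are `± 1`. -/
def IsNumericallyPrime {n : ℕ} (z : LaurentPolynomial (GroupRing n)) : Prop :=
  ∀ l : ℤ, (l : LaurentPolynomial (GroupRing n)) ∣ z → l = 1 ∨ l = -1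

/-! ### Free complexes and Morse numbers -/

/-- A free complex over a commutative ring `A`: a finite complex
`0 ← C₀ ← C₁ ← ⋯ ← C_N ← 0` of finitely generated free `A`-modules. -/
structure IsFreeComplex {A : Type} [CommRing A] (C : ChainComplex (ModuleCat.{0} A) ℕ) :
    Prop where
  free : ∀ i, Module.Free A (C.X i)
  finite : ∀ i, Module.Finite A (C.X i)
  bounded : ∃ N : ℕ, ∀ i, N < i → Limits.IsZero (C.X i)

/-- The Morse number of a free complex `C`: the minimal number of free generators (in all
degrees together) of a free complex chain homotopy equivalent to `C`. -/
def morseNumber {A : Type} [CommRing A] (C : ChainComplex (ModuleCat.{0} A) ℕ) : ℕ :=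
  sInf {m : ℕ | ∃ D : ChainComplex (ModuleCat.{0} A) ℕ, IsFreeComplex D ∧
    Nonempty (HomotopyEquiv C D) ∧ m = ∑ᶠ i, Module.finrank A (D.X i)}

/-! ### Truncations of `R[[t]]`-complexes -/

/-- The functor sending an `R[[t]]`-module `M` to the `R`-module `M / t^k M`. -/
def truncFunctor (A : Type) [CommRing A] (k : ℕ) :
    ModuleCat.{0} A⟦X⟧ ⥤ ModuleCat.{0} A where
  obj M := (ModuleCat.restrictScalars (algebraMap A A⟦X⟧)).obj
    (ModuleCat.of A⟦X⟧ (M ⧸ (Ideal.span {(PowerSeries.X : A⟦X⟧) ^ k} • ⊤ : Submodule A⟦X⟧ M)))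
  map f := (ModuleCat.restrictScalars (algebraMap A A⟦X⟧)).map
    (ModuleCat.ofHom (Submodule.mapQ _ _ f.hom (Submodule.smul_top_le_comap_smul_top _ _)))
  map_id M := by
    ext x
    obtain ⟨y, rfl⟩ := Submodule.Quotient.mk_surjective _ x
    rfl
  map_comp f g := by
    ext x
    obtain ⟨y, rfl⟩ := Submodule.Quotient.mk_surjective _ x
    rfl

instance truncFunctor_additive (A : Type) [CommRing A] (k : ℕ) :
    (truncFunctor A k).Additive where
  map_add {M N f g} := by
    ext x
    obtain ⟨y, rfl⟩ := Submodule.Quotient.mk_surjective _ x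
    rfl

/-- The `R`-complex `D[k] = D / t^k D` attached to an `R[[t]]`-complex `D`. -/
def truncComplex {A : Type} [CommRing A] (D : ChainComplex (ModuleCat.{0} A⟦X⟧) ℕ) (k : ℕ) :
    ChainComplex (ModuleCat.{0} A) ℕ :=
  ((truncFunctor A k).mapHomologicalComplex _).obj D

/-- `μ_k(D)`, the Morse number over `R` of `D / t^k D`. -/
def mu {A : Type} [CommRing A] (D : ChainComplex (ModuleCat.{0} A⟦X⟧) ℕ) (k : ℕ) : ℕ :=
  morseNumber (truncComplex D k)

/-! ### Basic subcomplexes, asymptotically linear growth, the invariant `s` -/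

/-- A basic subcomplex of an `R((t))`-complex `C`: a free `R[[t]]`-complex `D`, embedded in `C`
by an injective `R[[t]]`-linear chain map, such that every element of `C` is of the form
`t^{-l} d` with `d` in `D`, i.e. such that inverting `t` in `D` gives the whole of `C`. -/
structure BasicSubcomplex {A : Type} [CommRing A]
    (C : ChainComplex (ModuleCat.{0} A⸨X⸩) ℕ) where
  /-- the underlying `R[[t]]`-complex -/
  complex : ChainComplex (ModuleCat.{0} A⟦X⟧) ℕ
  isFree : IsFreeComplex complex
  /-- the inclusion -/
  incl : ∀ i, complex.X i →ₛₗ[algebraMap A⟦X⟧ A⸨X⸩] C.X i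
  incl_injective : ∀ i, Function.Injective (incl i)
  incl_comm : ∀ i j (x : complex.X i), incl j (complex.d i j x) = C.d i j (incl i x)
  exists_mem : ∀ i (c : C.X i), ∃ (l : ℕ) (d : complex.X i),
    incl i d = (algebraMap A⟦X⟧ A⸨X⸩ (PowerSeries.X ^ l)) • c

/-- A real sequence `a_k` is asymptotically linear if `α k - K ≤ a_k ≤ α k + K` for some
constants `K, α` and all `k`. -/
def AsymptoticallyLinear (a : ℕ → ℝ) : Prop :=
  ∃ K α : ℝ, ∀ k : ℕ, α * k - K ≤ a k ∧ a k ≤ α * k + K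

/-- `C` is of asymptotically linear growth: for some basic subcomplex `D`, the sequence
`μ_k(D)` is asymptotically linear. -/
def HasAsymptoticallyLinearGrowth {A : Type} [CommRing A]
    (C : ChainComplex (ModuleCat.{0} A⸨X⸩) ℕ) : Prop :=
  ∃ D : BasicSubcomplex C, AsymptoticallyLinear fun k => (mu D.complex k : ℝ)

/-- `s(C) = v`: basic subcomplexes `D` of `C` exist, and `lim μ_k(D)/k` exists and
equals `v` for every one of them. -/
def HasSInvariant {A : Type} [CommRing A] (C : ChainComplex (ModuleCat.{0} A⸨X⸩) ℕ) (v : ℝ) :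
    Prop :=
  Nonempty (BasicSubcomplex C) ∧
    ∀ D : BasicSubcomplex C, Tendsto (fun k : ℕ => (mu D.complex k : ℝ) / k) atTop (𝓝 v)

/-! ### Complexes of principal type -/

/-- A structure of principal type on an `𝓛`-complex `C`: for every `i` a fixed isomorphism
`H_i(C) ≈ 𝓛^{b_i} ⊕ ⨁_s 𝓛/a_s^{(i)}𝓛`, where the `a_s^{(i)} ∈ R[t, t⁻¹]` are special, non-zero
and not monic, and each of them divides (in `𝓛`) the following ones. -/
structure PrincipalType {n : ℕ} (C : ChainComplex (ModuleCat.{0} (LaurentRing n)) ℕ) where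
  /-- the rank of the free summand of `H_i` -/
  b : ℕ → ℕ
  /-- the number of cyclic torsion summands of `H_i` -/
  q : ℕ → ℕ
  /-- the Laurent polynomials `a_s^{(i)}` -/
  a : ∀ i, Fin (q i) → LaurentPolynomial (GroupRing n)
  /-- the isomorphism -/
  iso : ∀ i, C.homology i ≃ₗ[LaurentRing n]
    ((Fin (b i) → LaurentRing n) ×
      (∀ s : Fin (q i), LaurentRing n ⧸ Ideal.span {toLaurentSeries (a i s)}))
  special : ∀ i s, IsSpecial (a i s)
  ne_zero : ∀ i s, a i s ≠ 0
  not_monic : ∀ i s, ¬ IsMonic (a i s)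
  dvd : ∀ i (s s' : Fin (q i)), s ≤ s' → toLaurentSeries (a i s) ∣ toLaurentSeries (a i s')

/-- `κ_i`: the number of indices `s` for which `a_s^{(i)}` is not numerically prime. -/
def PrincipalType.kappa {n : ℕ} {C : ChainComplex (ModuleCat.{0} (LaurentRing n)) ℕ}
    (P : PrincipalType C) (i : ℕ) : ℕ :=
  Nat.card {s : Fin (P.q i) // ¬ IsNumericallyPrime (P.a i s)}

end MorseGrowth

end

open CategoryTheory Filter Topology
open scoped PowerSeries LaurentSeries LaurentPolynomial

noncomputable section

namespace MorseGrowth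

/-! ### Stable range and cancellation -/

section StableRange

variable {R : Type*} [CommRing R]

/-! The multipliers `a_s` are non-zero-divisors, so every homology module has a free resolution of
length one. By Schanuel's lemma the cycles and boundaries of `C` are then stably free, and after
adding elementary contractible summands `C` takes diagonal form: copies of `𝓛` and two-term
complexes `𝓛 → 𝓛` given by `1` or by some `a_s` (`exists_adapted_maps`). A basic subcomplex `D`,
stabilized in the same way, is a lattice `E` in this complex. It inherits the diagonal coordinates
up to powers of `t` that do not depend on `k` (`PrincipalType.exists_adapted`), so they cost only a
bounded error.

Call a two-term summand good if its multiplier is `1` or numerically prime, and let `γ` be the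
number of good summands. The total rank of `E` is `∑ b + 2 ∑ κ + 2γ`, so it must be shown that `μ_k`
equals `k (rank E - 2γ)` up to a constant.

Upper bound: the coefficients of a numerically prime special polynomial generate the unit ideal.
Multiplication by it is therefore split injective over `R` on polynomials of degree less than `K`,
with image in degrees less than `K + l` (`exists_leftInverse_mul_coeffs`). With `k - K` constant,
each good summand allows `K` pairs of generators of `E / t^k E` to be cancelled. The remaining
modules are only stably free, but Bass cancellation makes them free, since `ℤ[ℤⁿ]` has finite stable
range (`Adapted.mu_add_le`).

Lower bound: in each degree the divisibility chain provides one prime `p` dividing all multipliers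
that are not numerically prime (`PrincipalType.exists_prime`). Modulo `p` only good summands
contribute to the differential, whose rank is thus at most their number times `k`, plus a constant
(`Adapted.diffRank_le`). Small ranks over fields force a large Morse number, and the field may vary
with the degree (`sum_finrank_le_add_diffRank`). -/

/-- A ring has stable range at most `d` if every unimodular row of length more than `d` can be
shortened. -/
def HasStableRange (R : Type*) [CommRing R] (d : ℕ) : Prop :=
  ∀ m, d ≤ m → ∀ (a₀ : R) (a : Fin m → R), Ideal.span (insert a₀ (Set.range a)) = ⊤ →
    ∃ b : Fin m → R, Ideal.span (Set.range fun j => a j + b j * a₀) = ⊤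

/-- Prime avoidance: `c` is taken in every prime of `S` that omits `a` and outside every prime of
`S` that contains `a`. Incomparability of the primes makes this possible. -/
theorem exists_add_mul_notMem_of_finite {S : Set (Ideal R)} (hS : S.Finite)
    (hp : ∀ Q ∈ S, Q.IsPrime) (hinc : ∀ Q ∈ S, ∀ Q' ∈ S, Q ≤ Q' → Q = Q') {a₀ : R}
    (h₀ : ∀ Q ∈ S, a₀ ∉ Q) (a : R) : ∃ c : R, ∀ Q ∈ S, a + c * a₀ ∉ Q := by
  classical
  let T : Finset (Ideal R) := hS.toFinset.filter fun Q => a ∈ Q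
  let T' : Finset (Ideal R) := hS.toFinset.filter fun Q => a ∉ Q
  have hT : ∀ Q, Q ∈ T ↔ Q ∈ S ∧ a ∈ Q := by simp [T]
  have hT' : ∀ Q, Q ∈ T' ↔ Q ∈ S ∧ a ∉ Q := by simp [T']
  have h : ¬ (((T'.inf id : Ideal R) : Set R) ⊆ ⋃ Q ∈ (T : Set (Ideal R)), (Q : Set R)) := by
    rw [Ideal.subset_union_prime (f := fun Q => Q) ⊥ ⊥ fun Q hQ _ _ => hp Q ((hT Q).1 hQ).1]
    rintro ⟨Q, hQ, hle⟩
    obtain ⟨hQS, haQ⟩ := (hT Q).1 hQ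
    obtain ⟨Q', hQ', hle'⟩ := (Ideal.IsPrime.inf_le' (hp Q hQS)).1 hle
    obtain ⟨hQS', haQ'⟩ := (hT' Q').1 hQ'
    exact haQ' (hinc Q' hQS' Q hQS hle' ▸ haQ)
  obtain ⟨c, hc, hcT⟩ := Set.not_subset.1 h
  refine ⟨c, fun Q hQ hmem => ?_⟩
  have := hp Q hQ
  by_cases haQ : a ∈ Q
  · have hcQ : c ∉ Q := fun h => hcT (Set.mem_biUnion (show Q ∈ (T : Set _) from
      (hT Q).2 ⟨hQ, haQ⟩) h)
    exact ((Ideal.IsPrime.mem_or_mem this ((Q.add_mem_iff_right haQ).1 hmem)).elim hcQ (h₀ Q hQ))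
  · have hcQ : c ∈ Q := (Finset.inf_le ((hT' Q).2 ⟨hQ, haQ⟩) : T'.inf id ≤ Q) hc
    exact haQ ((Q.add_mem_iff_left (Q.mul_mem_right _ hcQ)).1 hmem)

/-- Each new entry is chosen outside the finitely many minimal primes, not containing `a₀`, of the
ideal of the previous entries. A prime containing the enlarged ideal but not `a₀` lies strictly
above one of these, so its height grows by one. -/
theorem exists_forall_le_height [IsNoetherianRing R] (a₀ : R) (a : ℕ → R) (i : ℕ) :
    ∃ b : ℕ → R, ∀ P : Ideal R, P.IsPrime → a₀ ∉ P → (∀ j < i, a j + b j * a₀ ∈ P) →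
      (i : ℕ∞) ≤ P.height := by
  induction i with
  | zero => exact ⟨0, by simp⟩
  | succ i ih =>
    obtain ⟨b, hb⟩ := ih
    let I : Ideal R := Ideal.span ((fun j => a j + b j * a₀) '' Set.Iio i)
    let S : Set (Ideal R) := {Q | Q ∈ I.minimalPrimes ∧ a₀ ∉ Q}
    obtain ⟨c, hc⟩ := exists_add_mul_notMem_of_finite (S := S)
      ((Ideal.finite_minimalPrimes_of_isNoetherianRing R I).subset fun Q hQ => hQ.1)
      (fun Q hQ => hQ.1.1.1) (fun Q hQ Q' hQ' hle => le_antisymm hle (hQ'.1.2 hQ.1.1 hle))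
      (fun Q hQ => hQ.2) (a i)
    refine ⟨Function.update b i c, fun P hP hP₀ hmem => ?_⟩
    have hIP : I ≤ P := by
      refine Ideal.span_le.2 ?_
      rintro _ ⟨j, hj, rfl⟩
      have hj' : j < i := hj
      have := hmem j (by lia)
      rwa [Function.update_of_ne hj'.ne] at this
    obtain ⟨Q, hQ, hQP⟩ := Ideal.exists_minimalPrimes_le hIP
    have hQ₀ : a₀ ∉ Q := fun h => hP₀ (hQP h)
    have hQp : Q.IsPrime := hQ.1.1
    have hlt : Q < P := by
      refine lt_of_le_of_ne hQP ?_
      rintro rfl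
      have := hmem i (by lia)
      rw [Function.update_self] at this
      exact hc Q ⟨hQ, hQ₀⟩ this
    have h1 := hb Q hQp hQ₀ fun j hj => hQ.1.2 (Ideal.subset_span ⟨j, hj, rfl⟩)
    have h2 := Ideal.height_add_one_le_of_lt_of_isPrime hlt
    refine le_trans ?_ h2
    push_cast
    gcongr

/-- Bass' stable range theorem. -/
theorem hasStableRange_of_ringKrullDim_lt [IsNoetherianRing R] {d : ℕ}
    (hd : ringKrullDim R < d) : HasStableRange R d := by
  intro m hm a₀ a ha
  let a' : ℕ → R := fun j => if h : j < m then a ⟨j, h⟩ else 0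
  obtain ⟨b, hb⟩ := exists_forall_le_height a₀ a' m
  refine ⟨fun j => b j, ?_⟩
  by_contra hne
  obtain ⟨P, hP, hle⟩ := Ideal.exists_le_maximal _ hne
  have hPp := hP.isPrime
  have hmem : ∀ j : Fin m, a j + b j * a₀ ∈ P := fun j => hle (Ideal.subset_span ⟨j, rfl⟩)
  -- A maximal ideal containing the shortened row either contains `a₀`, hence the whole unimodular
  -- row, or has height at least `m`, above the Krull dimension.
  by_cases h₀ : a₀ ∈ P
  · refine hP.ne_top (top_le_iff.1 (ha ▸ Ideal.span_le.2 ?_))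
    rintro x (rfl | ⟨j, rfl⟩)
    · exact h₀
    · exact (P.add_mem_iff_left (P.mul_mem_left _ h₀)).1 (hmem j)
  · have h1 := hb P hPp h₀ fun j hj => by simpa [a', hj] using hmem ⟨j, hj⟩
    have h2 : (P.height : WithBot ℕ∞) ≤ ringKrullDim R :=
      Ideal.height_le_ringKrullDim_of_ne_top hP.ne_top
    have h3 : ((m : ℕ∞) : WithBot ℕ∞) ≤ P.height := by exact_mod_cast h1
    have h4 := (h3.trans h2).trans_lt hd
    have : m < d := by exact_mod_cast h4
    lia

/-- A split surjection identifies its source with the product of its kernel and its target. -/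
def prodEquivOfRightInverse {M P : Type*} [AddCommGroup M] [Module R M] [AddCommGroup P]
    [Module R P] (f : M →ₗ[R] P) (s : P →ₗ[R] M) (h : ∀ x, f (s x) = x) :
    (LinearMap.ker f × P) ≃ₗ[R] M where
  toFun w := w.1 + s w.2
  map_add' w w' := by simp; abel
  map_smul' r w := by simp
  invFun x := (⟨x - s (f x), by simp [h]⟩, f x)
  left_inv w := by ext <;> simp [h]
  right_inv x := by simp

/-- `Q` is the kernel of a unimodular functional `f` on `R × R^m`. A shear carries `f` to the
shortened row `f'` on the second factor alone, so `Q` is `ker f' × R`. This is `R^m`, because `f'`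
is a split surjection onto `R`. -/
theorem HasStableRange.nonempty_equiv_of_prod {d : ℕ} (hR : HasStableRange R d) {Q : Type*}
    [AddCommGroup Q] [Module R Q] {m : ℕ} (hm : d ≤ m)
    (e : (Q × R) ≃ₗ[R] (R × (Fin m → R))) : Nonempty (Q ≃ₗ[R] (Fin m → R)) := by
  classical
  let f : R × (Fin m → R) →ₗ[R] R := LinearMap.snd R Q R ∘ₗ e.symm.toLinearMap
  have hf : Function.Surjective f := fun r => ⟨e (0, r), by simp [f]⟩
  let a₀ : R := f (1, 0)
  let a : Fin m → R := fun j => f (0, Pi.single j 1)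
  have hfa : ∀ x y, f (x, y) = x * a₀ + ∑ j, y j * a j := by
    intro x y
    have h1 : (x, y) = x • ((1 : R), (0 : Fin m → R)) +
        ∑ j, y j • ((0 : R), (Pi.single j 1 : Fin m → R)) := by
      ext i
      · simp [Prod.fst_sum]
      · simp [Prod.snd_sum, Finset.sum_apply, Pi.single_apply]
    simp only [h1, map_add, map_smul, map_sum, smul_eq_mul, a₀, a]
  have huni : Ideal.span (insert a₀ (Set.range a)) = ⊤ := by
    rw [Ideal.eq_top_iff_one]
    obtain ⟨⟨x, y⟩, hxy⟩ := hf 1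
    rw [← hxy, hfa]
    refine Ideal.add_mem _ (Ideal.mul_mem_left _ _ (Ideal.subset_span (by simp))) ?_
    exact Ideal.sum_mem _ fun j _ => Ideal.mul_mem_left _ _ (Ideal.subset_span (by simp))
  obtain ⟨b, hb⟩ := hR m hm a₀ a huni
  let f' : (Fin m → R) →ₗ[R] R := Fintype.linearCombination R fun j => a j + b j * a₀
  have hf'a : ∀ y, f' y = ∑ j, y j * (a j + b j * a₀) := fun y => by
    simp [f', Fintype.linearCombination_apply]
  have h1 : ∃ y₀, f' y₀ = 1 := by
    have : (1 : R) ∈ Ideal.span (Set.range fun j => a j + b j * a₀) := hb ▸ Submodule.mem_top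
    rw [Ideal.span, Submodule.mem_span_range_iff_exists_fun] at this
    obtain ⟨c, hc⟩ := this
    exact ⟨c, by simpa [hf'a] using hc⟩
  obtain ⟨y₀, hy₀⟩ := h1
  let β : (Fin m → R) →ₗ[R] R := Fintype.linearCombination R b
  have hβ : ∀ y, f' y = ∑ j, y j * a j + β y * a₀ := fun y => by
    simp [hf'a, β, Fintype.linearCombination_apply, mul_add, Finset.sum_add_distrib,
      Finset.sum_mul, mul_assoc]
  -- Since `f' y₀ = 1`, subtracting `(x * a₀) • y₀` compensates the term `x * a₀`, while adding `β`
  -- turns the row `a` into `a + b a₀`.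
  have key : ∀ x y, f (x + β (y - (x * a₀) • y₀), y - (x * a₀) • y₀) = f' y := by
    intro x y
    have := hβ (y - (x * a₀) • y₀)
    rw [map_sub, map_smul, hy₀] at this
    rw [hfa]
    simp only [smul_eq_mul, mul_one] at this
    linear_combination -this
  let shear : (R × (Fin m → R)) ≃ₗ[R] (R × (Fin m → R)) :=
    { toFun := fun w => (w.1 + β (w.2 - (w.1 * a₀) • y₀), w.2 - (w.1 * a₀) • y₀)
      map_add' := fun w w' => by
        ext i
        · simp [add_mul, add_smul]; ring
        · simp [add_mul, add_smul]; ring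
      map_smul' := fun r w => by
        ext i
        · simp; ring
        · simp; ring
      invFun := fun w => (w.1 - β w.2, w.2 + ((w.1 - β w.2) * a₀) • y₀)
      left_inv := fun w => by ext <;> simp
      right_inv := fun w => by ext <;> simp }
  have hshear : ∀ w, f (shear w) = f' w.2 := fun w => key w.1 w.2
  let q : Q →ₗ[R] R × (Fin m → R) := shear.symm.toLinearMap ∘ₗ e.toLinearMap ∘ₗ LinearMap.inl R Q R
  have hq : ∀ z, f' (q z).2 = 0 := fun z => by
    rw [← hshear]
    simp [q, f]
  have hq2 : ∀ x y, f' y = 0 → (e.symm (shear (x, y))).2 = 0 := fun x y hy => by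
    have := hshear (x, y)
    rw [hy] at this
    exact this
  let E : Q ≃ₗ[R] (LinearMap.ker f' × R) :=
    { toFun := fun z => (⟨(q z).2, hq z⟩, (q z).1)
      map_add' := fun z z' => by ext <;> simp
      map_smul' := fun r z => by ext <;> simp
      invFun := fun w => (e.symm (shear (w.2, w.1))).1
      left_inv := fun z => by simp [q]
      right_inv := fun w => by
        have h3 : ((e.symm (shear (w.2, (w.1 : Fin m → R)))).1, (0 : R)) =
            e.symm (shear (w.2, w.1)) := by
          ext
          · rfl
          · exact (hq2 w.2 w.1 w.1.2).symm
        have h4 : q (e.symm (shear (w.2, (w.1 : Fin m → R)))).1 = (w.2, (w.1 : Fin m → R)) := by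
          simp [q, h3]
        ext
        · simp [h4]
        · simp [h4] }
  exact ⟨E.trans (prodEquivOfRightInverse f' (LinearMap.toSpanSingleton R _ y₀)
    fun x => by simp [hy₀])⟩

/-- Bass' cancellation theorem for stably free modules of large rank. -/
theorem HasStableRange.nonempty_equiv_of_prod_fin {d : ℕ} (hR : HasStableRange R d) {Q : Type*}
    [AddCommGroup Q] [Module R Q] {m : ℕ} (hm : d ≤ m) (u : ℕ)
    (e : (Q × (Fin u → R)) ≃ₗ[R] (Fin (m + u) → R)) : Nonempty (Q ≃ₗ[R] (Fin m → R)) := by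
  induction u with
  | zero => exact ⟨(LinearEquiv.prodUnique (M₂ := Fin 0 → R)).symm.trans e⟩
  | succ u ih =>
    have e1 : ((Q × (Fin u → R)) × R) ≃ₗ[R] (Q × (Fin (u + 1) → R)) :=
      (LinearEquiv.prodAssoc R Q (Fin u → R) R).trans (LinearEquiv.prodCongr (.refl R Q)
        ((LinearEquiv.prodComm R _ _).trans (Fin.consLinearEquiv R fun _ => R)))
    obtain ⟨e'⟩ := hR.nonempty_equiv_of_prod (m := m + u) (by lia)
      (e1.trans (e.trans (Fin.consLinearEquiv R fun _ : Fin (m + u + 1) => R).symm))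
    exact ih e'

end StableRange

/-! ### Multiplication by a power series with unimodular coefficients -/

section Toeplitz

variable {R : Type*} [CommRing R]

/-- The polynomial of degree less than `K` with given coefficients, as a power series. -/
def ofCoeffs (R : Type*) [CommRing R] (K : ℕ) : (Fin K → R) →ₗ[R] R⟦X⟧ :=
  Fintype.linearCombination R fun j : Fin K => (PowerSeries.X : R⟦X⟧) ^ (j : ℕ)

theorem ofCoeffs_apply {K : ℕ} (x : Fin K → R) :
    ofCoeffs R K x = ∑ j, x j • (PowerSeries.X : R⟦X⟧) ^ (j : ℕ) :=
  Fintype.linearCombination_apply ..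

theorem coeff_ofCoeffs {K : ℕ} (x : Fin K → R) (j : Fin K) :
    PowerSeries.coeff (j : ℕ) (ofCoeffs R K x) = x j := by
  simp [ofCoeffs_apply, PowerSeries.coeff_X_pow, Fin.val_inj]

/-- It suffices that the transpose `T` of the multiplication matrix is surjective. Otherwise some
non-zero functional to a residue field `R ⧸ 𝔪` kills its image. That functional is a polynomial `Ξ`
of degree less than `K` whose product with `a` mod `𝔪` has order at least `K + l`. Orders add over a
field, and they are at most `K - 1` and `l`. -/
theorem exists_leftInverse_mul_coeffs (a : R⟦X⟧) {l : ℕ}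
    (ha : Ideal.span ((fun i => PowerSeries.coeff i a) '' Set.Iic l) = ⊤) (K : ℕ) :
    ∃ ρ : (Fin (K + l) → R) →ₗ[R] (Fin K → R), ∀ x : Fin K → R,
      ρ (fun s => PowerSeries.coeff (s : ℕ) (ofCoeffs R K x * a)) = x := by
  classical
  let t : Fin K → Fin (K + l) → R := fun j s =>
    PowerSeries.coeff (s : ℕ) ((PowerSeries.X : R⟦X⟧) ^ (j : ℕ) * a)
  let T : (Fin (K + l) → R) →ₗ[R] (Fin K → R) :=
    LinearMap.pi fun j => Fintype.linearCombination R (t j)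
  have hT : ∀ y j, T y j = ∑ s, y s * t j s := fun y j => by
    simp [T, Fintype.linearCombination_apply]
  have hsurj : LinearMap.range T = ⊤ := by
    by_contra hne
    obtain ⟨W, hW, hle⟩ := (eq_top_or_exists_le_coatom (LinearMap.range T)).resolve_left hne
    have hs : IsSimpleModule R ((Fin K → R) ⧸ W) := isSimpleModule_iff_isCoatom.2 hW
    obtain ⟨𝔪, h𝔪, ⟨e⟩⟩ := isSimpleModule_iff_quot_maximal.1 hs
    let _ := Ideal.Quotient.field 𝔪
    let ξ : (Fin K → R) →ₗ[R] R ⧸ 𝔪 := e.toLinearMap ∘ₗ W.mkQ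
    have hξ0 : ∀ y, ξ (T y) = 0 := fun y => by
      have : T y ∈ W := hle ⟨y, rfl⟩
      simp [ξ, (Submodule.Quotient.mk_eq_zero W).2 this]
    let Ξ : (R ⧸ 𝔪)⟦X⟧ := ofCoeffs (R ⧸ 𝔪) K fun j => ξ (Pi.single j 1)
    have hξ : ∀ y : Fin K → R, ξ y = ∑ j, y j • ξ (Pi.single j 1) := fun y => by
      conv_lhs => rw [pi_eq_sum_univ' y]
      rw [map_sum]
      exact Finset.sum_congr rfl fun j _ => by rw [map_smul]
    let a' : (R ⧸ 𝔪)⟦X⟧ := PowerSeries.map (Ideal.Quotient.mk 𝔪) a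
    have hΞ : Ξ ≠ 0 := by
      intro h0
      have h1 : ∀ y, ξ y = 0 := fun y => by
        rw [hξ]
        refine Finset.sum_eq_zero fun j _ => ?_
        have := coeff_ofCoeffs (fun j => ξ (Pi.single j 1)) j
        rw [show ofCoeffs (R ⧸ 𝔪) K (fun j => ξ (Pi.single j 1)) = 0 from h0] at this
        rw [← this]
        simp
      have h2 : Function.Surjective ξ := e.surjective.comp W.mkQ_surjective
      obtain ⟨y, hy⟩ := h2 1
      exact one_ne_zero (hy.symm.trans (h1 y))
    obtain ⟨i, hi⟩ : ∃ i : Fin K, PowerSeries.coeff (i : ℕ) Ξ ≠ 0 := by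
      by_contra! h0
      refine hΞ ?_
      have : (fun j => ξ (Pi.single j 1)) = 0 := by
        ext1 j
        rw [← coeff_ofCoeffs (fun j => ξ (Pi.single j 1)) j]
        exact h0 j
      simp [Ξ, this]
    obtain ⟨i', hi'l, hi'⟩ : ∃ i' ≤ l, PowerSeries.coeff i' a' ≠ 0 := by
      by_contra! h0
      refine h𝔪.ne_top (top_le_iff.1 (ha ▸ Ideal.span_le.2 ?_))
      rintro _ ⟨i', hi', rfl⟩
      have := h0 i' hi'
      rwa [PowerSeries.coeff_map, Ideal.Quotient.eq_zero_iff_mem] at this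
    have ho1 : Ξ.order ≤ (i : ℕ) := PowerSeries.order_le _ hi
    have ho2 : a'.order ≤ i' := PowerSeries.order_le _ hi'
    have ho : (Ξ * a').order ≤ ((i + i' : ℕ) : ℕ∞) := by
      rw [PowerSeries.order_mul]
      push_cast
      exact add_le_add ho1 ho2
    have hc : ∀ s : ℕ, s < K + l → PowerSeries.coeff s (Ξ * a') = 0 := by
      intro s hs
      have h0 := hξ0 (Pi.single ⟨s, hs⟩ 1)
      rw [hξ] at h0
      rw [← h0]
      simp only [Ξ, ofCoeffs_apply, Finset.sum_mul, map_sum, a']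
      refine Finset.sum_congr rfl fun j _ => ?_
      rw [hT, Finset.sum_eq_single ⟨s, hs⟩ (by intro b _ hb; simp [hb]) (by simp)]
      simp only [Pi.single_eq_same, one_mul, t]
      rw [smul_mul_assoc, map_smul, smul_eq_mul, Algebra.smul_def, mul_comm]
      congr 1
      rw [show ((PowerSeries.X : (R ⧸ 𝔪)⟦X⟧) ^ (j : ℕ)) =
        PowerSeries.map (Ideal.Quotient.mk 𝔪) (PowerSeries.X ^ (j : ℕ)) by simp, ← map_mul,
        PowerSeries.coeff_map]
      rfl
    have hlt : ((K + l : ℕ) : ℕ∞) ≤ (Ξ * a').order := PowerSeries.nat_le_order _ _ hc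
    have := hlt.trans ho
    have : K + l ≤ i + i' := by exact_mod_cast this
    have := i.2
    lia
  have hex : ∀ j : Fin K, ∃ y, T y = Pi.single j 1 := fun j => by
    have : (Pi.single j 1 : Fin K → R) ∈ LinearMap.range T := hsurj ▸ Submodule.mem_top
    exact this
  -- Preimages of the basis vectors form a right inverse of `T`; its transpose is the left inverse
  -- sought.
  choose y hy using hex
  refine ⟨LinearMap.pi fun j => Fintype.linearCombination R (y j), fun x => ?_⟩
  ext j
  have h1 : ∀ s : Fin (K + l), PowerSeries.coeff (s : ℕ) (ofCoeffs R K x * a) =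
      ∑ i, x i * t i s := fun s => by
    simp [ofCoeffs_apply, Finset.sum_mul, t]
  simp only [h1, LinearMap.pi_apply, Fintype.linearCombination_apply, smul_eq_mul,
    Finset.sum_mul]
  rw [Finset.sum_comm]
  have h2 : ∀ i, ∑ s, x i * t i s * y j s = x i * (Pi.single j 1 : Fin K → R) i := fun i => by
    rw [← hy j, hT, Finset.mul_sum]
    exact Finset.sum_congr rfl fun s _ => by ring
  simp [h2, Pi.single_apply]

end Toeplitz

/-! ### The group ring of `ℤⁿ` and special Laurent polynomials -/

section GroupRing

variable {n : ℕ}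

instance : IsNoetherianRing (GroupRing n) := Algebra.FiniteType.isNoetherianRing ℤ _

theorem exists_hasStableRange (n : ℕ) : ∃ d, HasStableRange (GroupRing n) d := by
  obtain ⟨N, f, hf⟩ := Algebra.FiniteType.iff_quotient_mvPolynomial''.1
    (inferInstance : Algebra.FiniteType ℤ (GroupRing n))
  refine ⟨N + 2, hasStableRange_of_ringKrullDim_lt ?_⟩
  refine (ringKrullDim_le_of_surjective f.toRingHom hf).trans_lt ?_
  rw [MvPolynomial.ringKrullDim_of_isNoetherianRing,
    IsPrincipalIdealRing.ringKrullDim_eq_one ℤ Int.not_isField]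
  simp
  norm_cast
  lia

/-- The augmentation `ℤ[ℤⁿ] → ℤ → A`. -/
def augmentation (n : ℕ) (A : Type*) [CommRing A] : GroupRing n →+* A :=
  (algebraMap ℤ A).comp (AddMonoidAlgebra.lift ℤ ℤ (Fin n → ℤ) 1).toRingHom

@[simp]
theorem coeff_toLaurentSeries (z : LaurentPolynomial (GroupRing n)) (i : ℤ) :
    (toLaurentSeries z).coeff i = z.coeff i := rfl

theorem intCast_dvd_laurentPolynomial {z : LaurentPolynomial (GroupRing n)} {d : ℤ}
    (h : ∀ i, (d : GroupRing n) ∣ z.coeff i) : (d : LaurentPolynomial (GroupRing n)) ∣ z := by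
  have : ∀ i, ∃ r, z.coeff i = d * r := h
  choose r hr using this
  rw [← AddMonoidAlgebra.sum_coeff_single z]
  refine Finset.dvd_sum fun i _ => ⟨AddMonoidAlgebra.single i (r i), ?_⟩
  rw [hr, ← zsmul_eq_mul, ← zsmul_eq_mul, AddMonoidAlgebra.smul_single]

theorem intCast_dvd_coeff {x y : LaurentRing n} {d : ℤ} (h : x = d * y) (i : ℤ) :
    x.coeff i = d * y.coeff i := by
  rw [h, ← zsmul_eq_mul, ← zsmul_eq_mul]
  rfl

theorem toLaurentSeries_intCast_mul (d : ℤ) (z : LaurentPolynomial (GroupRing n)) :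
    toLaurentSeries ((d : LaurentPolynomial (GroupRing n)) * z) =
      (d : LaurentRing n) * toLaurentSeries z := by
  ext i
  rw [intCast_dvd_coeff (n := n) rfl i, coeff_toLaurentSeries, coeff_toLaurentSeries,
    ← zsmul_eq_mul, ← zsmul_eq_mul]
  rfl

theorem toLaurentSeries_ne_zero {z : LaurentPolynomial (GroupRing n)} (hz : z ≠ 0) :
    toLaurentSeries z ≠ 0 := by
  intro h
  refine hz ?_
  ext i : 2
  rw [← coeff_toLaurentSeries, h]
  rfl

/-- The power series obtained from a Laurent polynomial by dividing by a power of `t`. -/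
def toPowerSeries (z : LaurentPolynomial (GroupRing n)) : (GroupRing n)⟦X⟧ :=
  (toLaurentSeries z).powerSeriesPart

theorem toPowerSeries_ne_zero {z : LaurentPolynomial (GroupRing n)} (hz : z ≠ 0) :
    toPowerSeries z ≠ 0 :=
  (LaurentSeries.powerSeriesPart_eq_zero _).not.2 (toLaurentSeries_ne_zero hz)

/-- The power of `t` that is divided out is a unit of `𝓛`, so the cyclic summands of homology do not
change. -/
theorem span_toPowerSeries (z : LaurentPolynomial (GroupRing n)) :
    Ideal.span {algebraMap (GroupRing n)⟦X⟧ (LaurentRing n) (toPowerSeries z)} =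
      Ideal.span {toLaurentSeries z} := by
  have h := LaurentSeries.single_order_mul_powerSeriesPart (toLaurentSeries z)
  set o := (toLaurentSeries z).order
  have hu : IsUnit (HahnSeries.single o 1 : LaurentRing n) := by
    refine IsUnit.of_mul_eq_one (HahnSeries.single (-o) 1) ?_
    simp
  conv_rhs => rw [← h]
  rw [Ideal.span_singleton_mul_left_unit hu]
  rfl

theorem intCast_dvd_toPowerSeries {z : LaurentPolynomial (GroupRing n)} {d : ℤ}
    (h : (d : LaurentRing n) ∣ toLaurentSeries z) : (d : (GroupRing n)⟦X⟧) ∣ toPowerSeries z := by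
  obtain ⟨y, hy⟩ := h
  refine ⟨PowerSeries.mk fun i => y.coeff ((toLaurentSeries z).order + i), ?_⟩
  ext1 i
  rw [toPowerSeries, LaurentSeries.powerSeriesPart_coeff, intCast_dvd_coeff hy, ← zsmul_eq_mul,
    ← zsmul_eq_mul, map_zsmul, PowerSeries.coeff_mk]

/-- Group elements are units, so the ideal of coefficients contains the integers `c j`. Their gcd
divides `z`, hence is `± 1`; finitely many coefficients suffice to express `1`. -/
theorem exists_span_coeff_toPowerSeries {z : LaurentPolynomial (GroupRing n)}
    (hs : IsSpecial z) (hp : IsNumericallyPrime z) :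
    ∃ l, Ideal.span ((fun i => PowerSeries.coeff i (toPowerSeries z)) '' Set.Iic l) = ⊤ := by
  choose g c hc using hs
  set J := Ideal.span (Set.range fun i => PowerSeries.coeff i (toPowerSeries z))
  have hcJ : ∀ j, z.coeff j ∈ J := by
    intro j
    by_cases hj : z.coeff j = 0
    · rw [hj]
      exact J.zero_mem
    have hle : (toLaurentSeries z).order ≤ j := HahnSeries.order_le_of_coeff_ne_zero hj
    obtain ⟨i, hi⟩ := Int.le.dest hle
    refine Ideal.subset_span ⟨i, ?_⟩
    simp only [toPowerSeries, LaurentSeries.powerSeriesPart_coeff, hi, coeff_toLaurentSeries]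
  have hJ : (1 : GroupRing n) ∈ J := by
    obtain ⟨d, hd⟩ := (IsPrincipalIdealRing.principal (Ideal.span (Set.range c))).principal
    have hd' : ∀ j, d ∣ c j := fun j => by
      rw [← Ideal.mem_span_singleton, ← Ideal.submodule_span_eq, ← hd]
      exact Ideal.subset_span ⟨j, rfl⟩
    have hd1 : d = 1 ∨ d = -1 := by
      refine hp d (intCast_dvd_laurentPolynomial fun j => ?_)
      obtain ⟨e, he⟩ := hd' j
      refine ⟨AddMonoidAlgebra.single (g j) e, ?_⟩
      rw [hc, he, ← zsmul_eq_mul, AddMonoidAlgebra.smul_single, smul_eq_mul]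
    have h1 : (1 : ℤ) ∈ Ideal.span (Set.range c) := by
      rw [hd]
      rcases hd1 with rfl | rfl <;> simp
    have hle : Ideal.span (Set.range c) ≤ J.comap (algebraMap ℤ (GroupRing n)) := by
      rw [Ideal.span_le]
      rintro _ ⟨j, rfl⟩
      have := J.mul_mem_left (AddMonoidAlgebra.single (-g j) 1) (hcJ j)
      rw [hc, AddMonoidAlgebra.single_mul_single] at this
      simpa using this
    simpa using hle h1
  obtain ⟨f, hf⟩ := Finsupp.mem_span_range_iff_exists_finsupp.1 hJ
  refine ⟨f.support.sup id, (Ideal.eq_top_iff_one _).2 (hf ▸ ?_)⟩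
  exact Ideal.sum_mem _ fun i hi => Ideal.mul_mem_left _ _ (Ideal.subset_span
    ⟨i, Finset.le_sup (f := id) hi, rfl⟩)

theorem exists_prime_dvd_of_not_isNumericallyPrime {z : LaurentPolynomial (GroupRing n)}
    (hp : ¬ IsNumericallyPrime z) :
    ∃ p : ℕ, p.Prime ∧ ((p : ℤ) : LaurentRing n) ∣ toLaurentSeries z := by
  simp only [IsNumericallyPrime, not_forall, not_or] at hp
  obtain ⟨l, hl, h1, h2⟩ := hp
  have hl1 : l.natAbs ≠ 1 := by lia
  obtain ⟨p, hp, hpl⟩ := Nat.exists_prime_and_dvd hl1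
  refine ⟨p, hp, ?_⟩
  obtain ⟨m, rfl⟩ := Int.natCast_dvd.2 hpl
  obtain ⟨y, rfl⟩ := hl
  rw [Int.cast_mul, mul_assoc, toLaurentSeries_intCast_mul]
  exact dvd_mul_right _ _

end GroupRing

/-! ### Homotopy equivalences of chain complexes of modules -/

section Homotopy

variable {R : Type} [CommRing R]

/-- A homotopy equivalence obtained from a section and a contraction of its complement. -/
def homotopyEquivOfRetract {G B : ChainComplex (ModuleCat.{0} R) ℕ} (j : G ⟶ B) (p : B ⟶ G)
    (h : ∀ i, B.X i →ₗ[R] B.X (i + 1)) (hjp : j ≫ p = 𝟙 G)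
    (h₀ : ∀ x, j.f 0 (p.f 0 x) = x - B.d 1 0 (h 0 x))
    (hs : ∀ i x, j.f (i + 1) (p.f (i + 1) x) =
      x - h i (B.d (i + 1) i x) - B.d (i + 2) (i + 1) (h (i + 1) x)) :
    HomotopyEquiv B G where
  hom := p
  inv := j
  homotopyInvHomId := Homotopy.ofEq hjp
  homotopyHomInvId := by
    let H : ∀ i k, (ComplexShape.down ℕ).Rel k i → (B.X i ⟶ B.X k) := fun i k hik =>
      ModuleCat.ofHom (h i) ≫ eqToHom (by rw [show i + 1 = k from hik])
    refine ((Homotopy.equivSubZero.symm ((Homotopy.ofEq ?_).trans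
      (Homotopy.nullHomotopy' H))).symm :)
    ext i x
    match i with
    | 0 =>
      rw [Homotopy.nullHomotopicMap'_f_of_not_rel_left (show (ComplexShape.down ℕ).Rel 1 0 from rfl)
        (by simp)]
      simp [H, h₀]
    | i + 1 =>
      rw [Homotopy.nullHomotopicMap'_f (show (ComplexShape.down ℕ).Rel (i + 2) (i + 1) from rfl)
        (show (ComplexShape.down ℕ).Rel (i + 1) i from rfl)]
      simp [H, hs]
      abel

/-- The sequence moved up by one place, starting with `0`. -/
def shift (u : ℕ → ℕ) : ℕ → ℕ
  | 0 => 0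
  | i + 1 => u i

/-! ### Cancelling pairs of generators -/

section Cancel

variable (B : ChainComplex (ModuleCat.{0} R) ℕ) {u : ℕ → ℕ}
  (θ : ∀ i, B.X i →ₗ[R] (Fin (u i) → R))

/-- The subcomplex on which the functionals `θ` and their composites with the differential
vanish. -/
def cancelSubmodule (i : ℕ) : Submodule R (B.X i) :=
  LinearMap.ker (θ i) ⊓ ⨅ j, LinearMap.ker (θ j ∘ₗ (B.d i j).hom)

variable {B θ}

theorem mem_cancelSubmodule {i : ℕ} {x : B.X i} :
    x ∈ cancelSubmodule B θ i ↔ θ i x = 0 ∧ ∀ j, θ j (B.d i j x) = 0 := by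
  simp [cancelSubmodule]

theorem mem_cancelSubmodule_zero {x : B.X 0} :
    x ∈ cancelSubmodule B θ 0 ↔ θ 0 x = 0 := by
  rw [mem_cancelSubmodule]
  refine ⟨fun h => h.1, fun h => ⟨h, fun j => ?_⟩⟩
  rw [B.shape _ _ (by simp)]
  simp

theorem mem_cancelSubmodule_succ {i : ℕ} {x : B.X (i + 1)} :
    x ∈ cancelSubmodule B θ (i + 1) ↔ θ (i + 1) x = 0 ∧ θ i (B.d (i + 1) i x) = 0 := by
  rw [mem_cancelSubmodule]
  refine ⟨fun h => ⟨h.1, h.2 i⟩, fun h => ⟨h.1, fun j => ?_⟩⟩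
  by_cases hj : j + 1 = i + 1
  · obtain rfl : j = i := by lia
    exact h.2
  · rw [B.shape _ _ hj]
    simp

theorem d_d_apply (B : ChainComplex (ModuleCat.{0} R) ℕ) (i j k : ℕ) (x : B.X i) :
    B.d j k (B.d i j x) = 0 := by
  rw [← ModuleCat.comp_apply, B.d_comp_d]
  rfl

variable (B θ)

/-- The complex obtained from `B` by cancelling the generators detected by `θ`. -/
def cancelComplex : ChainComplex (ModuleCat.{0} R) ℕ where
  X i := ModuleCat.of R (cancelSubmodule B θ i)
  d i j := ModuleCat.ofHom ((B.d i j).hom.restrict fun x hx => mem_cancelSubmodule.2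
    ⟨(mem_cancelSubmodule.1 hx).2 j, fun k => by
      change θ k (B.d j k (B.d i j x)) = 0
      rw [d_d_apply, map_zero]⟩)
  shape i j hij := by
    ext x
    simp [B.shape i j hij]
  d_comp_d' i j k _ _ := by
    refine ModuleCat.hom_ext (LinearMap.ext fun x => Subtype.ext ?_)
    exact d_d_apply B i j k x.1

variable {B θ} {ι : ∀ i, (Fin (u i) → R) →ₗ[R] B.X (i + 1)}

/-- The images of `ι` and `d ∘ ι` span a contractible direct summand. `π` is the projection along
it, and `ι ∘ θ` is the contracting homotopy. -/
theorem nonempty_homotopyEquiv_cancelComplex (h₁ : ∀ i x, θ i (B.d (i + 1) i (ι i x)) = x)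
    (h₂ : ∀ i x, θ (i + 1) (ι i x) = 0) :
    Nonempty (HomotopyEquiv B (cancelComplex B θ)) := by
  let π : ∀ i, B.X i →ₗ[R] B.X i
    | 0 => LinearMap.id - (B.d 1 0).hom ∘ₗ ι 0 ∘ₗ θ 0
    | i + 1 => LinearMap.id - (ι i ∘ₗ θ i) ∘ₗ (B.d (i + 1) i).hom -
        (B.d (i + 2) (i + 1)).hom ∘ₗ ι (i + 1) ∘ₗ θ (i + 1)
  have hπ₀ : ∀ x, π 0 x = x - B.d 1 0 (ι 0 (θ 0 x)) := fun x => rfl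
  have hπs : ∀ i x, π (i + 1) x = x - ι i (θ i (B.d (i + 1) i x)) -
      B.d (i + 2) (i + 1) (ι (i + 1) (θ (i + 1) x)) := fun i x => rfl
  have hmem : ∀ i x, π i x ∈ cancelSubmodule B θ i := by
    rintro (_ | i) x
    · rw [mem_cancelSubmodule_zero, hπ₀, map_sub, h₁, sub_self]
    · rw [mem_cancelSubmodule_succ, hπs]
      simp only [map_sub, h₁, h₂, d_d_apply, sub_zero, sub_self, and_self]
  have hπ : ∀ i x, x ∈ cancelSubmodule B θ i → π i x = x := by
    rintro (_ | i) x hx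
    · rw [mem_cancelSubmodule_zero] at hx
      simp [hπ₀, hx]
    · rw [mem_cancelSubmodule_succ] at hx
      simp [hπs, hx]
  have hd : ∀ i x, B.d (i + 1) i (π (i + 1) x) = π i (B.d (i + 1) i x) := by
    rintro (_ | i) x
    · rw [hπs, hπ₀]
      simp only [map_sub, d_d_apply, sub_zero]
    · rw [hπs, hπs]
      simp only [map_sub, d_d_apply, sub_zero, map_zero]
  let j : cancelComplex B θ ⟶ B :=
    { f := fun i => ModuleCat.ofHom (cancelSubmodule B θ i).subtype
      comm' := fun i k _ => by ext x; rfl }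
  let p : B ⟶ cancelComplex B θ :=
    { f := fun i => ModuleCat.ofHom ((π i).codRestrict _ (hmem i))
      comm' := fun i k hik => by
        obtain rfl : k + 1 = i := hik
        ext x
        exact Subtype.ext (hd k x) }
  refine ⟨homotopyEquivOfRetract j p (fun i => ι i ∘ₗ θ i) ?_ (fun x => rfl) (fun i x => rfl)⟩
  ext i x
  exact Subtype.ext (hπ i x.1 x.2)

/-- The functionals `θ` and `θ ∘ d` have the common section formed by `d ∘ ι` and `ι`. Complements
of free modules need not be free, so the terms left after cancellation are so far only stably free.
-/
theorem nonempty_cancelSubmodule_prod_equiv (h₁ : ∀ i x, θ i (B.d (i + 1) i (ι i x)) = x)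
    (h₂ : ∀ i x, θ (i + 1) (ι i x) = 0) (i : ℕ) :
    Nonempty ((cancelSubmodule B θ i × (Fin (u i + shift u i) → R)) ≃ₗ[R] B.X i) := by
  rcases i with _ | i
  · have e := prodEquivOfRightInverse (θ 0) ((B.d 1 0).hom ∘ₗ ι 0) fun x => h₁ 0 x
    have hk : cancelSubmodule B θ 0 = LinearMap.ker (θ 0) := by
      ext x
      rw [mem_cancelSubmodule_zero, LinearMap.mem_ker]
    rw [hk]
    exact ⟨e⟩
  · let P : B.X (i + 1) →ₗ[R] (Fin (u (i + 1)) → R) × (Fin (u i) → R) :=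
      (θ (i + 1)).prod (θ i ∘ₗ (B.d (i + 1) i).hom)
    let s : (Fin (u (i + 1)) → R) × (Fin (u i) → R) →ₗ[R] B.X (i + 1) :=
      ((B.d (i + 2) (i + 1)).hom ∘ₗ ι (i + 1)).coprod (ι i)
    have e := prodEquivOfRightInverse P s fun x => by
      refine Prod.ext ?_ ?_
      · change θ (i + 1) (B.d (i + 2) (i + 1) (ι (i + 1) x.1) + ι i x.2) = x.1
        rw [map_add, h₁, h₂, add_zero]
      · change θ i (B.d (i + 1) i (B.d (i + 2) (i + 1) (ι (i + 1) x.1) + ι i x.2)) = x.2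
        rw [map_add, d_d_apply, zero_add, h₁]
    have hk : cancelSubmodule B θ (i + 1) = LinearMap.ker P := by
      ext x
      rw [mem_cancelSubmodule_succ, LinearMap.mem_ker]
      exact Prod.mk_eq_zero.symm
    rw [hk]
    exact ⟨((LinearEquiv.refl R _).prodCongr 
      (LinearEquiv.sumArrowLequivProdArrow _ _ R R |>.symm.trans
      (LinearEquiv.funCongrLeft R R finSumFinEquiv.symm)).symm).trans e⟩

end Cancel

/-! ### Adding elementary contractible complexes -/

section Stabilize

variable (D : ChainComplex (ModuleCat.{0} R) ℕ) (f : ℕ → ℕ)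

/-- The terms of a stabilization. -/
abbrev StabilizeX (i : ℕ) : Type :=
  D.X i × (Fin (f i) → R) × (Fin (shift f i) → R)

/-- The differential of a stabilization. -/
def stabilizeD (i : ℕ) : StabilizeX D f (i + 1) →ₗ[R] StabilizeX D f i :=
  ((D.d (i + 1) i).hom ∘ₗ LinearMap.fst R _ _).prod
      ((LinearMap.snd R _ _ ∘ₗ LinearMap.snd R _ _).prod 0)

/-- The direct sum of `D` and the elementary contractible complexes `R^{f i} = R^{f i}` in
degrees `i + 1` and `i`. -/
def stabilize : ChainComplex (ModuleCat.{0} R) ℕ :=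
  ChainComplex.of (fun i => ModuleCat.of R (StabilizeX D f i))
    (fun i => ModuleCat.ofHom (stabilizeD D f i))
    fun i => ModuleCat.hom_ext (LinearMap.ext fun x =>
      Prod.ext (d_d_apply D (i + 2) (i + 1) i x.1) rfl)

theorem stabilize_d (i : ℕ) :
    (stabilize D f).d (i + 1) i = ModuleCat.ofHom (stabilizeD D f i) :=
  ChainComplex.of_d (fun i => ModuleCat.of R (StabilizeX D f i))
    (fun i => ModuleCat.ofHom (stabilizeD D f i)) i

/-- The inclusion of a complex in a stabilization. -/
def stabilizeInl : D ⟶ stabilize D f where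
  f i := ModuleCat.ofHom (LinearMap.inl R (D.X i) ((Fin (f i) → R) × (Fin (shift f i) → R)))
  comm' i k hik := by
    obtain rfl : k + 1 = i := hik
    rw [stabilize_d]
    rfl

/-- The projection of a stabilization to the original complex. -/
def stabilizeFst : stabilize D f ⟶ D where
  f i := ModuleCat.ofHom (LinearMap.fst R (D.X i) ((Fin (f i) → R) × (Fin (shift f i) → R)))
  comm' i k hik := by
    obtain rfl : k + 1 = i := hik
    rw [stabilize_d]
    rfl

/-- The contraction of the complement of a complex in a stabilization. -/
def stabilizeH (i : ℕ) : StabilizeX D f i →ₗ[R] StabilizeX D f (i + 1) :=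
  (LinearMap.inr R (D.X (i + 1)) ((Fin (f (i + 1)) → R) × (Fin (f i) → R))) ∘ₗ
    (LinearMap.inr R (Fin (f (i + 1)) → R) (Fin (f i) → R)) ∘ₗ
      (LinearMap.fst R _ _) ∘ₗ (LinearMap.snd R (D.X i) _)

theorem stabilizeH_zero (x : StabilizeX D f 0) :
    LinearMap.inl R (D.X 0) ((Fin (f 0) → R) × (Fin (shift f 0) → R)) x.1 =
      x - stabilizeD D f 0 (stabilizeH D f 0 x) := by
  refine Prod.ext ?_ (Prod.ext ?_ ?_)
  · change x.1 = x.1 - D.d 1 0 0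
    rw [map_zero, sub_zero]
  · exact (sub_self x.2.1).symm
  · exact Subsingleton.elim (α := Fin 0 → R) _ _

theorem stabilizeH_succ (i : ℕ) (x : StabilizeX D f (i + 1)) :
    LinearMap.inl R (D.X (i + 1)) ((Fin (f (i + 1)) → R) × (Fin (shift f (i + 1)) → R)) x.1 =
      x - stabilizeH D f i (stabilizeD D f i x) -
        stabilizeD D f (i + 1) (stabilizeH D f (i + 1) x) := by
  refine Prod.ext ?_ (Prod.ext ?_ ?_)
  · change x.1 = x.1 - 0 - D.d (i + 2) (i + 1) 0
    rw [map_zero, sub_zero, sub_zero]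
  · change 0 = x.2.1 - 0 - x.2.1
    rw [sub_zero, sub_self]
  · change 0 = x.2.2 - x.2.2 - 0
    rw [sub_zero, sub_self]

/-- A complex is homotopy equivalent to its stabilizations. -/
def stabilizeHomotopyEquiv : HomotopyEquiv (stabilize D f) D :=
  homotopyEquivOfRetract (stabilizeInl D f) (stabilizeFst D f) (stabilizeH D f)
    rfl (fun x => by rw [stabilize_d]; exact stabilizeH_zero D f x)
    fun i x => by rw [stabilize_d, stabilize_d]; exact stabilizeH_succ D f i x

end Stabilize

end Homotopy

/-! ### Ranks of differentials and a lower bound for the Morse number -/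

section Rank

/-- For cycles `Z` and boundaries `B` this compares Betti numbers: `f` induces an injection from `Z`
modulo `B` to `Z'` modulo `B'`. -/
theorem finrank_add_finrank_le {F V V' : Type*} [Field F] [AddCommGroup V] [Module F V]
    [FiniteDimensional F V] [AddCommGroup V'] [Module F V'] [FiniteDimensional F V']
    (f : V →ₗ[F] V') {B Z : Submodule F V} {B' Z' : Submodule F V'}
    (hB' : B' ≤ Z') (hZ : ∀ z ∈ Z, f z ∈ Z') (hB : ∀ z ∈ Z, f z ∈ B' → z ∈ B) :
    Module.finrank F Z + Module.finrank F B' ≤ Module.finrank F Z' + Module.finrank F B := by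
  let q : Z →ₗ[F] V' ⧸ B' := B'.mkQ ∘ₗ f ∘ₗ Z.subtype
  let g : Z' →ₗ[F] V' ⧸ B' := B'.mkQ ∘ₗ Z'.subtype
  have h1 := q.finrank_range_add_finrank_ker
  have h2 := g.finrank_range_add_finrank_ker
  have h3 : LinearMap.ker g = B'.comap Z'.subtype := by
    rw [LinearMap.ker_comp, Submodule.ker_mkQ]
  have h4 : Module.finrank F (LinearMap.ker g) = Module.finrank F B' := by
    rw [h3]
    exact (Submodule.comapSubtypeEquivOfLe hB').finrank_eq
  have h5 : LinearMap.range q ≤ LinearMap.range g := by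
    rintro _ ⟨z, rfl⟩
    exact ⟨⟨f z, hZ z z.2⟩, rfl⟩
  have h6 := Submodule.finrank_mono h5
  have h7 : Module.finrank F (LinearMap.ker q) ≤ Module.finrank F B := by
    refine LinearMap.finrank_le_finrank_of_injective
      (f := (Z.subtype ∘ₗ (LinearMap.ker q).subtype).codRestrict B fun z => ?_) ?_
    · exact hB z z.1.2 ((Submodule.Quotient.mk_eq_zero B').1 z.2)
    · intro z z' h
      exact Subtype.ext (Subtype.ext (congrArg (fun b : B => (b : V)) h))
  lia

variable {R : Type} [CommRing R]

/-- The rank of the differential `C_{i+1} → C_i` after base change to a field. -/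
def diffRank (F : Type) [Field F] [Algebra R F] (B : ChainComplex (ModuleCat.{0} R) ℕ) (i : ℕ) :
    ℕ :=
  Module.finrank F (LinearMap.range ((B.d (i + 1) i).hom.baseChange F))

/-- The rank of the differential starting in degree `i` after base change to a field. -/
def diffRankFrom (F : Type) [Field F] [Algebra R F] (B : ChainComplex (ModuleCat.{0} R) ℕ)
    (i : ℕ) : ℕ :=
  Module.finrank F (LinearMap.range ((B.d i ((ComplexShape.down ℕ).next i)).hom.baseChange F))

variable (F : Type) [Field F] [Algebra R F]

theorem diffRankFrom_zero (B : ChainComplex (ModuleCat.{0} R) ℕ) : diffRankFrom F B 0 = 0 := by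
  rw [diffRankFrom, B.shape _ _ (by simp), ModuleCat.hom_zero, LinearMap.baseChange_zero,
    LinearMap.range_zero, finrank_bot]

theorem diffRankFrom_succ (B : ChainComplex (ModuleCat.{0} R) ℕ) (i : ℕ) :
    diffRankFrom F B (i + 1) = diffRank F B i := by
  rw [diffRankFrom, diffRank, ChainComplex.next_nat_succ]

variable {F}

/-- After base change to `F`, the homotopy equivalence is injective on homology in degree `i`, whose
dimension is the rank of the module minus the ranks of the two adjacent differentials. -/
theorem finrank_add_diffRank_le {B G : ChainComplex (ModuleCat.{0} R) ℕ} (hB : IsFreeComplex B)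
    (hG : IsFreeComplex G) (e : HomotopyEquiv B G) (i : ℕ) :
    Module.finrank R (B.X i) + diffRankFrom F G i + diffRank F G i ≤
      Module.finrank R (G.X i) + diffRankFrom F B i + diffRank F B i := by
  have := hB.free i
  have := hB.finite i
  have := hG.free i
  have := hG.finite i
  have : Nontrivial R := (algebraMap R F).domain_nontrivial
  obtain ⟨k, hk⟩ : ∃ k, k = (ComplexShape.down ℕ).next i := ⟨_, rfl⟩
  have hcomm := e.homotopyHomInvId.comm i
  let h := e.homotopyHomInvId.hom
  have h1 : (e.inv.f i).hom ∘ₗ (e.hom.f i).hom =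
      (h k i).hom ∘ₗ (B.d i k).hom + (B.d (i + 1) i).hom ∘ₗ (h i (i + 1)).hom + LinearMap.id := by
    rw [Homotopy.prevD_chainComplex, dNext_eq_dFrom_fromNext] at hcomm
    subst hk
    have := congrArg ModuleCat.Hom.hom hcomm
    exact this
  have hcl : ∀ (C : ChainComplex (ModuleCat.{0} R) ℕ), LinearMap.range
      ((C.d (i + 1) i).hom.baseChange F) ≤ LinearMap.ker ((C.d i k).hom.baseChange F) := by
    intro C
    rw [LinearMap.range_le_ker_iff, ← LinearMap.baseChange_comp]
    have : (C.d i k).hom ∘ₗ (C.d (i + 1) i).hom = 0 :=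
      LinearMap.ext fun x => d_d_apply C (i + 1) i k x
    rw [this, LinearMap.baseChange_zero]
  have hcomm' : ∀ {C E : ChainComplex (ModuleCat.{0} R) ℕ} (f : C ⟶ E) (a b : ℕ) x,
      (E.d a b).hom.baseChange F ((f.f a).hom.baseChange F x) =
        (f.f b).hom.baseChange F ((C.d a b).hom.baseChange F x) := by
    intro C E f a b x
    rw [← LinearMap.comp_apply, ← LinearMap.comp_apply, ← LinearMap.baseChange_comp,
      ← LinearMap.baseChange_comp]
    congr 2
    exact congrArg ModuleCat.Hom.hom (f.comm a b)
  have key := finrank_add_finrank_le ((e.hom.f i).hom.baseChange F)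
    (B := LinearMap.range ((B.d (i + 1) i).hom.baseChange F))
    (Z := LinearMap.ker ((B.d i k).hom.baseChange F)) (hcl G)
    (fun z hz => by
      rw [LinearMap.mem_ker] at hz ⊢
      rw [hcomm', hz, map_zero])
    (by
      rintro z hz ⟨y, hy⟩
      rw [LinearMap.mem_ker] at hz
      have h2 := congrArg (LinearMap.baseChange F) h1
      rw [LinearMap.baseChange_add, LinearMap.baseChange_add, LinearMap.baseChange_comp,
        LinearMap.baseChange_comp, LinearMap.baseChange_comp, LinearMap.baseChange_id] at h2
      have h3 := LinearMap.congr_fun h2 z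
      simp only [LinearMap.comp_apply, LinearMap.add_apply, hz, map_zero, zero_add,
        LinearMap.id_apply] at h3
      rw [← hy, ← hcomm'] at h3
      exact (Submodule.add_mem_iff_right _ (LinearMap.mem_range_self _ _)).1
        (h3 ▸ LinearMap.mem_range_self _ _))
  have r1 := ((B.d i k).hom.baseChange F).finrank_range_add_finrank_ker
  have r2 := ((G.d i k).hom.baseChange F).finrank_range_add_finrank_ker
  rw [Module.finrank_baseChange] at r1 r2
  unfold diffRankFrom diffRank
  rw [← hk]
  omega

theorem finrank_add_diffRank_eq {B G : ChainComplex (ModuleCat.{0} R) ℕ} (hB : IsFreeComplex B)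
    (hG : IsFreeComplex G) (e : HomotopyEquiv B G) (i : ℕ) :
    Module.finrank R (B.X i) + diffRankFrom F G i + diffRank F G i =
      Module.finrank R (G.X i) + diffRankFrom F B i + diffRank F B i :=
  le_antisymm (finrank_add_diffRank_le hB hG e i) (finrank_add_diffRank_le hG hB e.symm i)

variable (F)

theorem diffRank_eq_zero {B : ChainComplex (ModuleCat.{0} R) ℕ} {i : ℕ}
    (h : Limits.IsZero (B.X (i + 1))) : diffRank F B i = 0 := by
  rw [diffRank, h.eq_zero_of_src (B.d (i + 1) i), ModuleCat.hom_zero, LinearMap.baseChange_zero,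
    LinearMap.range_zero, finrank_bot]

/-- The difference `δ i` of the ranks of the differentials of `G` and `B` is determined recursively
by the ranks of the modules, so it is the same over every field. Hence `δ i ≥ -diffRank (F i) B i`
may be used with a different field in each degree. -/
theorem sum_finrank_le_add_diffRank (F : ℕ → Type) [∀ i, Field (F i)] [∀ i, Algebra R (F i)]
    {B G : ChainComplex (ModuleCat.{0} R) ℕ} (hB : IsFreeComplex B)
    (hG : IsFreeComplex G) (e : HomotopyEquiv B G) {N : ℕ}
    (hBN : ∀ i, N < i → Limits.IsZero (B.X i)) (hGN : ∀ i, N < i → Limits.IsZero (G.X i)) :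
    ∑ i ∈ Finset.range (N + 1), Module.finrank R (B.X i) ≤
      ∑ i ∈ Finset.range (N + 1), Module.finrank R (G.X i) +
        2 * ∑ i ∈ Finset.range N, diffRank (F i) B i := by
  let δ : ℕ → ℤ := fun i => Nat.rec
    ((Module.finrank R (G.X 0) : ℤ) - Module.finrank R (B.X 0))
    (fun i x => (Module.finrank R (G.X (i + 1)) : ℤ) - Module.finrank R (B.X (i + 1)) - x) i
  have hδs : ∀ i, δ (i + 1) =
    (Module.finrank R (G.X (i + 1)) : ℤ) - Module.finrank R (B.X (i + 1)) - δ i := fun i => rfl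
  have hδ : ∀ i j, (diffRank (F j) G i : ℤ) - diffRank (F j) B i = δ i := by
    intro i j
    induction i with
    | zero =>
      have := finrank_add_diffRank_eq (F := F j) hB hG e 0
      rw [diffRankFrom_zero, diffRankFrom_zero] at this
      change _ = (Module.finrank R (G.X 0) : ℤ) - Module.finrank R (B.X 0)
      lia
    | succ i ih =>
      have := finrank_add_diffRank_eq (F := F j) hB hG e (i + 1)
      rw [diffRankFrom_succ, diffRankFrom_succ] at this
      rw [hδs]
      lia
  have hsum : ∀ M : ℕ, ∑ i ∈ Finset.range (M + 1), (Module.finrank R (G.X i) : ℤ) -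
      ∑ i ∈ Finset.range (M + 1), (Module.finrank R (B.X i) : ℤ) =
        2 * ∑ i ∈ Finset.range M, δ i + δ M := by
    intro M
    induction M with
    | zero => simp [δ]
    | succ M ih =>
      rw [Finset.sum_range_succ _ (M + 1), Finset.sum_range_succ (fun i => (_ : ℤ)) (M + 1),
        Finset.sum_range_succ δ M, hδs]
      linarith
  have hN : δ N = 0 := by
    rw [← hδ N 0, diffRank_eq_zero (F 0) (hBN _ (by lia)), diffRank_eq_zero (F 0) (hGN _ (by lia))]
    simp
  have hle : -∑ i ∈ Finset.range N, (diffRank (F i) B i : ℤ) ≤ ∑ i ∈ Finset.range N, δ i := by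
    rw [← Finset.sum_neg_distrib]
    exact Finset.sum_le_sum fun i _ => by rw [← hδ i i]; lia
  have := hsum N
  zify
  linarith

theorem finsum_finrank_eq [Nontrivial R] {B : ChainComplex (ModuleCat.{0} R) ℕ} {N : ℕ}
    (hN : ∀ i, N < i → Limits.IsZero (B.X i)) :
    ∑ᶠ i, Module.finrank R (B.X i) = ∑ i ∈ Finset.range (N + 1), Module.finrank R (B.X i) := by
  refine finsum_eq_sum_of_support_subset _ fun i hi => ?_
  by_contra hi'
  have := ModuleCat.subsingleton_of_isZero (hN i (by simpa using hi'))
  exact hi Module.finrank_zero_of_subsingleton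

theorem sum_finrank_le_morseNumber [Nontrivial R] (F : ℕ → Type) [∀ i, Field (F i)]
    [∀ i, Algebra R (F i)] {B : ChainComplex (ModuleCat.{0} R) ℕ} (hB : IsFreeComplex B) {N : ℕ}
    (hN : ∀ i, N < i → Limits.IsZero (B.X i)) :
    ∑ i ∈ Finset.range (N + 1), Module.finrank R (B.X i) ≤
      morseNumber B + 2 * ∑ i ∈ Finset.range N, diffRank (F i) B i := by
  have hne : {m : ℕ | ∃ D : ChainComplex (ModuleCat.{0} R) ℕ, IsFreeComplex D ∧
    Nonempty (HomotopyEquiv B D) ∧ m = ∑ᶠ i, Module.finrank R (D.X i)}.Nonempty :=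
    ⟨_, B, hB, ⟨HomotopyEquiv.refl B⟩, rfl⟩
  obtain ⟨G, hG, ⟨e⟩, hm⟩ := Nat.sInf_mem hne
  obtain ⟨N', hN'⟩ := hG.bounded
  -- The minimal complex `G` may extend beyond the degrees where `B` lives.
  have h1 := sum_finrank_le_add_diffRank F hB hG e (N := max N N')
    (fun i hi => hN i (by lia)) fun i hi => hN' i (by lia)
  rw [← finsum_finrank_eq fun i hi => hN' i (lt_of_le_of_lt (le_max_right N N') hi), ← hm,
    ← finsum_finrank_eq fun i hi => hN i (lt_of_le_of_lt (le_max_left N N') hi),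
    finsum_finrank_eq hN] at h1
  refine h1.trans (Nat.add_le_add_left (Nat.mul_le_mul_left 2 ?_) _)
  refine le_of_eq (Finset.sum_subset (by simp) fun i _ hi => ?_).symm
  exact diffRank_eq_zero _ (hN _ (by simp at hi; lia))

theorem morseNumber_le {B G : ChainComplex (ModuleCat.{0} R) ℕ} (hG : IsFreeComplex G)
    (e : HomotopyEquiv B G) : morseNumber B ≤ ∑ᶠ i, Module.finrank R (G.X i) :=
  Nat.sInf_le ⟨G, hG, ⟨e⟩, rfl⟩

theorem morseNumber_eq_of_homotopyEquiv {B B' : ChainComplex (ModuleCat.{0} R) ℕ}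
    (e : HomotopyEquiv B B') : morseNumber B = morseNumber B' := by
  unfold morseNumber
  congr 1
  ext m
  constructor
  · rintro ⟨G, hG, ⟨f⟩, hm⟩
    exact ⟨G, hG, ⟨e.symm.trans f⟩, hm⟩
  · rintro ⟨G, hG, ⟨f⟩, hm⟩
    exact ⟨G, hG, ⟨e.trans f⟩, hm⟩

end Rank

/-! ### Stably free modules and Schanuel's lemma -/

section StablyFree

variable {Λ : Type} [CommRing Λ]

/-- A finitely generated module that becomes free after adding a free module of finite rank. -/
def IsStablyFinFree (Λ : Type) [CommRing Λ] (P : Type) [AddCommGroup P] [Module Λ P] : Prop :=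
  ∃ x : ℕ, Module.Free Λ (P × (Fin x → Λ)) ∧ Module.Finite Λ (P × (Fin x → Λ))

variable {P Q : Type} [AddCommGroup P] [Module Λ P] [AddCommGroup Q] [Module Λ Q]

theorem IsStablyFinFree.of_equiv (h : IsStablyFinFree Λ P) (e : P ≃ₗ[Λ] Q) :
    IsStablyFinFree Λ Q := by
  obtain ⟨x, h1, h2⟩ := h
  exact ⟨x, .of_equiv (e.prodCongr (.refl Λ _)), .equiv (e.prodCongr (.refl Λ _))⟩

theorem isStablyFinFree_of_free [Module.Free Λ P] [Module.Finite Λ P] : IsStablyFinFree Λ P :=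
  ⟨0, inferInstance, inferInstance⟩

theorem IsStablyFinFree.projective (h : IsStablyFinFree Λ P) : Module.Projective Λ P := by
  obtain ⟨x, h1, h2⟩ := h
  exact .of_split (LinearMap.inl Λ P (Fin x → Λ)) (LinearMap.fst Λ P (Fin x → Λ)) (by ext; rfl)

theorem IsStablyFinFree.prod (hP : IsStablyFinFree Λ P) (hQ : IsStablyFinFree Λ Q) :
    IsStablyFinFree Λ (P × Q) := by
  obtain ⟨x, h1, h2⟩ := hP
  obtain ⟨y, h3, h4⟩ := hQ
  have e : ((P × (Fin x → Λ)) × (Q × (Fin y → Λ))) ≃ₗ[Λ] ((P × Q) × (Fin (x + y) → Λ)) :=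
    (LinearEquiv.prodProdProdComm Λ _ _ _ _).trans ((LinearEquiv.refl Λ _).prodCongr
      ((LinearEquiv.sumArrowLequivProdArrow _ _ Λ Λ).symm.trans
        (LinearEquiv.funCongrLeft Λ Λ finSumFinEquiv.symm)))
  exact ⟨x + y, .of_equiv e, .equiv e⟩

theorem IsStablyFinFree.of_prod (h : IsStablyFinFree Λ (P × Q)) (hQ : IsStablyFinFree Λ Q) :
    IsStablyFinFree Λ P := by
  obtain ⟨y, h3, h4⟩ := hQ
  obtain ⟨x, h1, h2⟩ := h
  have e : (((P × Q) × (Fin x → Λ)) × (Fin y → Λ)) ≃ₗ[Λ]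
      (P × ((Q × (Fin y → Λ)) × (Fin x → Λ))) :=
    { toFun := fun w => (w.1.1.1, (w.1.1.2, w.2), w.1.2)
      map_add' := fun _ _ => rfl
      map_smul' := fun _ _ => rfl
      invFun := fun w => (((w.1, w.2.1.1), w.2.2), w.2.1.2)
      left_inv := fun _ => rfl
      right_inv := fun _ => rfl }
  rcases subsingleton_or_nontrivial Λ with _ | _
  · have := Module.subsingleton Λ P
    exact ⟨0, inferInstance, inferInstance⟩
  have g := (Module.finBasis Λ ((Q × (Fin y → Λ)) × (Fin x → Λ))).equivFun
  have e' := e.trans ((LinearEquiv.refl Λ P).prodCongr g)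
  exact ⟨_, .of_equiv e', .equiv e'⟩

/-- Schanuel's lemma for a presentation of `Λ^b ⊕ ⨁ Λ/a_s`. -/
theorem exists_equiv_of_presentation {Z : Type} [AddCommGroup Z] [Module Λ Z]
    [Module.Projective Λ Z] {b q : ℕ} {a : Fin q → Λ}
    (p : Z →ₗ[Λ] (Fin b → Λ) × (∀ s, Λ ⧸ Ideal.span {a s})) (hp : Function.Surjective p) :
    ∃ Θ : (Z × (Fin b → Λ) × (Fin q → Λ)) ≃ₗ[Λ] (Z × (Fin b → Λ) × (Fin q → Λ)),
      ∀ w, p w.1 = 0 ↔ (Θ w).2.1 = 0 ∧ ∃ v, (Θ w).2.2 = a * v := by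
  let p' : (Fin b → Λ) × (Fin q → Λ) →ₗ[Λ] (Fin b → Λ) × (∀ s, Λ ⧸ Ideal.span {a s}) :=
    LinearMap.prodMap LinearMap.id (LinearMap.piMap fun s => (Ideal.span {a s}).mkQ)
  have hp' : Function.Surjective p' := by
    rintro ⟨x, y⟩
    have : ∀ s, ∃ r, (Ideal.span {a s}).mkQ r = y s := fun s => Submodule.mkQ_surjective _ _
    choose r hr using this
    exact ⟨(x, r), Prod.ext rfl (funext hr)⟩
  have hp0 : ∀ w, p' w = 0 ↔ w.1 = 0 ∧ ∃ v, w.2 = a * v := by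
    intro w
    have : p' w = (w.1, fun s => (Ideal.span {a s}).mkQ (w.2 s)) := rfl
    rw [this, Prod.mk_eq_zero]
    refine and_congr_right fun _ => ?_
    rw [funext_iff]
    have h1 : ∀ s, (Ideal.span {a s}).mkQ (w.2 s) = (0 : ∀ s, Λ ⧸ Ideal.span {a s}) s ↔
        ∃ c, w.2 s = a s * c := fun s => by
      rw [Pi.zero_apply, Submodule.mkQ_apply, Submodule.Quotient.mk_eq_zero,
        Ideal.mem_span_singleton]
      rfl
    simp only [h1]
    refine ⟨fun h => ?_, fun ⟨v, hv⟩ s => ⟨v s, by rw [hv]; rfl⟩⟩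
    choose v hv using h
    exact ⟨v, funext hv⟩
  obtain ⟨α, hα⟩ := Module.projective_lifting_property p' p hp'
  obtain ⟨β, hβ⟩ := Module.projective_lifting_property p p' hp
  have hα' : ∀ z, p' (α z) = p z := fun z => LinearMap.congr_fun hα z
  have hβ' : ∀ m, p (β m) = p' m := fun m => LinearMap.congr_fun hβ m
  -- The composite of two shears. Applied to the second component of the result, `p'` gives `p w.1`,
  -- as the terms `p' w.2` cancel.
  refine ⟨{ toFun := fun w => (w.1 - β w.2, w.2 + α (w.1 - β w.2))
            map_add' := fun w w' => by
              ext1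
              · simp only [Prod.fst_add, Prod.snd_add, map_add]; abel
              · simp only [Prod.fst_add, Prod.snd_add, map_add, map_sub]; abel
            map_smul' := fun r w => by
              ext1
              · simp [smul_sub]
              · simp only [Prod.smul_fst, Prod.smul_snd, map_smul, map_sub, RingHom.id_apply,
                  smul_add, smul_sub]
            invFun := fun w => (w.1 + β (w.2 - α w.1), w.2 - α w.1)
            left_inv := fun w => by simp
            right_inv := fun w => by simp }, fun w => ?_⟩
  change _ ↔ (w.2 + α (w.1 - β w.2)).1 = 0 ∧ ∃ v, (w.2 + α (w.1 - β w.2)).2 = a * v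
  rw [← hp0, map_add, hα', map_sub, hβ', add_sub_cancel]

end StablyFree

/-! ### The structure of complexes whose homology has short free resolutions -/

section Structure

variable {Λ : Type} [CommRing Λ] (C : ChainComplex (ModuleCat.{0} Λ) ℕ)

/-- The module of cycles in degree `i`. -/
def cyclesSubmodule (i : ℕ) : Submodule Λ (C.X i) :=
  LinearMap.ker (C.d i ((ComplexShape.down ℕ).next i)).hom

variable {C}

theorem mem_cyclesSubmodule_zero (x : C.X 0) : x ∈ cyclesSubmodule C 0 := by
  rw [cyclesSubmodule, C.shape _ _ (by simp)]
  simp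

theorem mem_cyclesSubmodule_succ {i : ℕ} {x : C.X (i + 1)} :
    x ∈ cyclesSubmodule C (i + 1) ↔ C.d (i + 1) i x = 0 := by
  rw [cyclesSubmodule, ChainComplex.next_nat_succ]
  rfl

theorem d_mem_cyclesSubmodule (i : ℕ) (x : C.X (i + 1)) :
    C.d (i + 1) i x ∈ cyclesSubmodule C i :=
  d_d_apply C _ _ _ x

theorem exists_ker_to_homology (S : ShortComplex (ModuleCat.{0} Λ)) {H : Type} [AddCommGroup H]
    [Module Λ H] (e : S.homology ≃ₗ[Λ] H) :
    ∃ p : LinearMap.ker S.g.hom →ₗ[Λ] H, Function.Surjective p ∧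
      ∀ z, p z = 0 ↔ (z : S.X₂) ∈ LinearMap.range S.f.hom := by
  let ι : S.homology ≃ₗ[Λ] (LinearMap.ker S.g.hom ⧸ LinearMap.range S.moduleCatToCycles) :=
    S.moduleCatHomologyIso.toLinearEquiv
  refine ⟨(ι.symm.trans e).toLinearMap ∘ₗ Submodule.mkQ _,
    (ι.symm.trans e).surjective.comp (Submodule.mkQ_surjective _), fun z => ?_⟩
  rw [LinearMap.comp_apply, LinearEquiv.coe_coe, LinearEquiv.map_eq_zero_iff,
    Submodule.mkQ_apply, Submodule.Quotient.mk_eq_zero]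
  constructor
  · rintro ⟨x, rfl⟩
    exact ⟨x, rfl⟩
  · rintro ⟨x, hx⟩
    exact ⟨x, Subtype.ext hx⟩

theorem exists_cycles_to_homology {i : ℕ} {H : Type} [AddCommGroup H] [Module Λ H]
    (e : C.homology i ≃ₗ[Λ] H) : ∃ p : cyclesSubmodule C i →ₗ[Λ] H, Function.Surjective p ∧
      ∀ z, p z = 0 ↔ (z : C.X i) ∈ LinearMap.range (C.d (i + 1) i).hom := by
  have h2 : LinearMap.range (C.d (i + 1) i).hom =
      LinearMap.range (C.d ((ComplexShape.down ℕ).prev i) i).hom := by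
    rw [ChainComplex.prev ℕ i]
  rw [h2]
  exact exists_ker_to_homology (C.sc i) e

end Structure

/-! ### Cycles and boundaries are stably free -/

section Structure

variable {Λ : Type} [CommRing Λ]

/-- Functions on `Fin (m + k)` as pairs of functions. -/
def finAddArrowEquiv (Λ : Type) [CommRing Λ] (m k : ℕ) :
    (Fin (m + k) → Λ) ≃ₗ[Λ] (Fin m → Λ) × (Fin k → Λ) :=
  (LinearEquiv.funCongrLeft Λ Λ finSumFinEquiv).trans
    (LinearEquiv.sumArrowLequivProdArrow _ _ Λ Λ)

/-- The added free module serves three purposes: `x` generators make `Z` free, and `b + q`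
generators make room for the Schanuel automorphism. In the new coordinates the boundaries of the
stabilized complex are the multiples of the diagonal. The vanishing of `x` and `y` when `Z = 0`
keeps the stabilization bounded. -/
theorem exists_adapted_equiv {Z : Type} [AddCommGroup Z] [Module Λ Z]
    (hZ : IsStablyFinFree Λ Z) {b q : ℕ} {a : Fin q → Λ}
    (p : Z →ₗ[Λ] (Fin b → Λ) × (∀ s, Λ ⧸ Ideal.span {a s})) (hp : Function.Surjective p) :
    ∃ x y : ℕ, (Subsingleton Z → x = 0 ∧ y = 0) ∧
      ∃ ζ : (Z × (Fin (x + b + q) → Λ)) ≃ₗ[Λ] (Fin y ⊕ Fin q → Λ) × (Fin b → Λ),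
        ∀ w, p w.1 = 0 ↔ (ζ w).2 = 0 ∧ ∃ v, (ζ w).1 = Sum.elim (1 : Fin y → Λ) a * v := by
  have hx : ∃ x y : ℕ, (Subsingleton Z → x = 0 ∧ y = 0) ∧
      Nonempty ((Z × (Fin x → Λ)) ≃ₗ[Λ] (Fin y → Λ)) := by
    by_cases hZ' : Subsingleton Z
    · have e : (Z × (Fin 0 → Λ)) ≃ₗ[Λ] (Fin 0 → Λ) :=
        { (0 : (Z × (Fin 0 → Λ)) →ₗ[Λ] (Fin 0 → Λ)) with
          invFun := fun _ => 0
          left_inv := fun _ => Subsingleton.elim _ _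
          right_inv := fun _ => Subsingleton.elim _ _ }
      exact ⟨0, 0, fun _ => ⟨rfl, rfl⟩, ⟨e⟩⟩
    · obtain ⟨x, h1, h2⟩ := hZ
      have : Nontrivial Λ := by
        by_contra h
        rw [not_nontrivial_iff_subsingleton] at h
        exact hZ' (Module.subsingleton Λ Z)
      exact ⟨x, _, fun h => (hZ' h).elim, ⟨(Module.finBasis Λ (Z × (Fin x → Λ))).equivFun⟩⟩
  obtain ⟨x, y, h0, ⟨g⟩⟩ := hx
  have := hZ.projective
  obtain ⟨Θ, hΘ⟩ := exists_equiv_of_presentation p hp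
  let E₁ : (Z × (Fin (x + b + q) → Λ)) ≃ₗ[Λ]
      ((Z × (Fin b → Λ) × (Fin q → Λ)) × (Fin x → Λ)) :=
    ((LinearEquiv.refl Λ Z).prodCongr ((finAddArrowEquiv Λ (x + b) q).trans
      ((finAddArrowEquiv Λ x b).prodCongr (LinearEquiv.refl Λ _)))).trans
      { toFun := fun w => ((w.1, w.2.1.2, w.2.2), w.2.1.1)
        map_add' := fun _ _ => rfl
        map_smul' := fun _ _ => rfl
        invFun := fun w => (w.1.1, (w.2, w.1.2.1), w.1.2.2)
        left_inv := fun _ => rfl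
        right_inv := fun _ => rfl }
  let E₂ : ((Z × (Fin b → Λ) × (Fin q → Λ)) × (Fin x → Λ)) ≃ₗ[Λ]
      ((Z × (Fin x → Λ)) × (Fin q → Λ)) × (Fin b → Λ) :=
      { toFun := fun w => (((w.1.1, w.2), w.1.2.2), w.1.2.1)
        map_add' := fun _ _ => rfl
        map_smul' := fun _ _ => rfl
        invFun := fun w => ((w.1.1.1, w.2, w.1.2), w.1.1.2)
        left_inv := fun _ => rfl
        right_inv := fun _ => rfl }
  let E₃ : (((Z × (Fin x → Λ)) × (Fin q → Λ)) × (Fin b → Λ)) ≃ₗ[Λ]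
      (Fin y ⊕ Fin q → Λ) × (Fin b → Λ) :=
    ((g.prodCongr (LinearEquiv.refl Λ (Fin q → Λ))).trans
      (LinearEquiv.sumArrowLequivProdArrow (Fin y) (Fin q) Λ Λ).symm).prodCongr
      (LinearEquiv.refl Λ _)
  refine ⟨x, y, h0, E₁.trans ((Θ.prodCongr (LinearEquiv.refl Λ _)).trans (E₂.trans E₃)),
    fun w => ?_⟩
  have h1 : (E₁ w).1.1 = w.1 := rfl
  rw [← h1, hΘ]
  set u := Θ (E₁ w).1
  have h2 : (E₁.trans ((Θ.prodCongr (LinearEquiv.refl Λ _)).trans (E₂.trans E₃))) w =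
      (Sum.elim (g (u.1, (E₁ w).2)) u.2.2, u.2.1) := by
    refine Prod.ext (funext fun s => ?_) rfl
    rcases s with s | s <;> rfl
  rw [h2]
  refine and_congr_right fun _ => ⟨fun ⟨v, hv⟩ => ?_, fun ⟨v, hv⟩ => ?_⟩
  · refine ⟨Sum.elim (g (u.1, (E₁ w).2)) v, funext fun s => ?_⟩
    rcases s with s | s
    · simp
    · simp [hv]
  · refine ⟨fun s => v (Sum.inr s), funext fun s => ?_⟩
    exact congrFun hv (Sum.inr s)

variable {C : ChainComplex (ModuleCat.{0} Λ) ℕ}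

theorem mul_left_injective_of_nonZeroDivisors {Ω : Type} {a : Ω → Λ}
    (ha : ∀ s, a s ∈ nonZeroDivisors Λ) {v w : Ω → Λ} (h : a * v = a * w) : v = w := by
  funext s
  have := congrFun h s
  exact (mul_cancel_left_mem_nonZeroDivisors (ha s)).1 this

/-- In Schanuel coordinates the pairs of a boundary and a vector of `Λ^b × Λ^q` are exactly the
triples `(z, 0, a * v)`. As the `a s` are non-zero-divisors, this identifies `B ⊕ Λ^b ⊕ Λ^q` with `Z
⊕ Λ^q`. -/
theorem isStablyFinFree_boundaries {i b q : ℕ} {a : Fin q → Λ}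
    (ha : ∀ s, a s ∈ nonZeroDivisors Λ) (hZ : IsStablyFinFree Λ (cyclesSubmodule C i))
    (p : cyclesSubmodule C i →ₗ[Λ] (Fin b → Λ) × (∀ s, Λ ⧸ Ideal.span {a s}))
    (hp : Function.Surjective p)
    (hp0 : ∀ z, p z = 0 ↔ (z : C.X i) ∈ LinearMap.range (C.d (i + 1) i).hom) :
    IsStablyFinFree Λ (LinearMap.range (C.d (i + 1) i).hom) := by
  have := hZ.projective
  obtain ⟨Θ, hΘ⟩ := exists_equiv_of_presentation p hp
  let g : cyclesSubmodule C i × (Fin q → Λ) →ₗ[Λ]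
      cyclesSubmodule C i × (Fin b → Λ) × (Fin q → Λ) :=
    LinearMap.prodMap LinearMap.id (LinearMap.inr Λ _ _ ∘ₗ LinearMap.mulLeft Λ a)
  have hg : ∀ w, g w = (w.1, 0, a * w.2) := fun w => rfl
  let G := Θ.symm.toLinearMap ∘ₗ g
  have hG : ∀ w, Θ (G w) = (w.1, 0, a * w.2) := fun w => by
    rw [← hg]
    exact Θ.apply_symm_apply _
  let E : cyclesSubmodule C i × (Fin q → Λ) →ₗ[Λ]
      LinearMap.range (C.d (i + 1) i).hom × ((Fin b → Λ) × (Fin q → Λ)) :=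
    (((cyclesSubmodule C i).subtype ∘ₗ LinearMap.fst Λ _ _ ∘ₗ G).codRestrict _ fun w =>
      (hp0 _).1 ((hΘ _).2 (by rw [hG]; exact ⟨rfl, _, rfl⟩))).prod (LinearMap.snd Λ _ _ ∘ₗ G)
  have hE1 : ∀ w, ((E w).1 : C.X i) = (G w).1 := fun w => rfl
  have hE2 : ∀ w, (E w).2 = (G w).2 := fun w => rfl
  have hE : Function.Bijective E := by
    constructor
    · intro w w' h
      have h1 : G w = G w' := by
        refine Prod.ext (Subtype.ext ?_) ?_
        · rw [← hE1, ← hE1, h]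
        · rw [← hE2, ← hE2, h]
      have h2 := congrArg Θ h1
      rw [hG, hG] at h2
      simp only [Prod.mk.injEq, true_and] at h2
      exact Prod.ext h2.1 (mul_left_injective_of_nonZeroDivisors ha h2.2)
    · rintro ⟨⟨x, hx⟩, m⟩
      have hxZ : x ∈ cyclesSubmodule C i := by
        obtain ⟨c, rfl⟩ := hx
        exact d_mem_cyclesSubmodule i c
      obtain ⟨h1, v, hv⟩ := (hΘ (⟨x, hxZ⟩, m)).1 ((hp0 _).2 hx)
      have h2 : G ((Θ (⟨x, hxZ⟩, m)).1, v) = (⟨x, hxZ⟩, m) := by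
        refine Θ.injective ?_
        rw [hG]
        exact Prod.ext rfl (Prod.ext h1.symm hv.symm)
      refine ⟨((Θ (⟨x, hxZ⟩, m)).1, v), Prod.ext (Subtype.ext ?_) ?_⟩
      · rw [hE1, h2]
      · rw [hE2, h2]
  exact ((hZ.prod isStablyFinFree_of_free).of_equiv (LinearEquiv.ofBijective E hE)).of_prod
    isStablyFinFree_of_free

/-- Induction on the degree: the boundaries `B_i` are projective, so `C_{i+1} ≅ Z_{i+1} ⊕ B_i`, and
stably free summands can be removed. -/
theorem isStablyFinFree_cycles (hC : IsFreeComplex C) {b q : ℕ → ℕ} {a : ∀ i, Fin (q i) → Λ}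
    (ha : ∀ i s, a i s ∈ nonZeroDivisors Λ)
    (p : ∀ i, cyclesSubmodule C i →ₗ[Λ] (Fin (b i) → Λ) × (∀ s, Λ ⧸ Ideal.span {a i s}))
    (hp : ∀ i, Function.Surjective (p i))
    (hp0 : ∀ i z, p i z = 0 ↔ (z : C.X i) ∈ LinearMap.range (C.d (i + 1) i).hom) (i : ℕ) :
    IsStablyFinFree Λ (cyclesSubmodule C i) := by
  induction i with
  | zero =>
    have := hC.free 0
    have := hC.finite 0
    have h : cyclesSubmodule C 0 = ⊤ := eq_top_iff.2 fun x _ => mem_cyclesSubmodule_zero x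
    rw [h]
    exact isStablyFinFree_of_free.of_equiv Submodule.topEquiv.symm
  | succ i ih =>
    have := hC.free (i + 1)
    have := hC.finite (i + 1)
    have hB := isStablyFinFree_boundaries (ha i) ih (p i) (hp i) (hp0 i)
    have := hB.projective
    obtain ⟨s, hs⟩ := Module.projective_lifting_property (C.d (i + 1) i).hom.rangeRestrict
      LinearMap.id (LinearMap.surjective_rangeRestrict _)
    have e := prodEquivOfRightInverse (C.d (i + 1) i).hom.rangeRestrict s
      fun x => LinearMap.congr_fun hs x
    have h : cyclesSubmodule C (i + 1) = LinearMap.ker (C.d (i + 1) i).hom.rangeRestrict := by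
      ext x
      rw [mem_cyclesSubmodule_succ, LinearMap.ker_rangeRestrict]
      rfl
    rw [h]
    exact (isStablyFinFree_of_free.of_equiv e.symm).of_prod hB

end Structure

/-! ### Diagonal form of the stabilized complex -/

section AdaptedMaps

variable {Λ : Type} [CommRing Λ]

theorem exists_sections {C : ChainComplex (ModuleCat.{0} Λ) ℕ}
    (hB : ∀ i, Module.Projective Λ (LinearMap.range (C.d (i + 1) i).hom)) :
    ∃ (s : ∀ i, LinearMap.range (C.d (i + 1) i).hom →ₗ[Λ] C.X (i + 1))
      (r : ∀ i, C.X i →ₗ[Λ] cyclesSubmodule C i),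
      (∀ i x, C.d (i + 1) i (s i x) = x) ∧ (∀ i (z : cyclesSubmodule C i), r i z = z) ∧
      (∀ x, (r 0 x : C.X 0) = x) ∧
      (∀ i x, (r (i + 1) x : C.X (i + 1)) + s i ⟨C.d (i + 1) i x, x, rfl⟩ = x) ∧
      ∀ i x, r (i + 1) (s i x) = 0 := by
  have hs : ∀ i, ∃ s : LinearMap.range (C.d (i + 1) i).hom →ₗ[Λ] C.X (i + 1),
      ∀ x, C.d (i + 1) i (s x) = x := fun i => by
    obtain ⟨s, hs⟩ := Module.projective_lifting_property (C.d (i + 1) i).hom.rangeRestrict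
      LinearMap.id (LinearMap.surjective_rangeRestrict _)
    exact ⟨s, fun x => congrArg Subtype.val (LinearMap.congr_fun hs x)⟩
  choose s hs using hs
  let r₀ : ∀ i, C.X i →ₗ[Λ] C.X i
    | 0 => LinearMap.id
    | i + 1 => LinearMap.id - s i ∘ₗ (C.d (i + 1) i).hom.rangeRestrict
  have hr₀ : ∀ x, r₀ 0 x = x := fun x => rfl
  have hrs : ∀ i x, r₀ (i + 1) x = x - s i ⟨C.d (i + 1) i x, x, rfl⟩ := fun i x => rfl
  have hmem : ∀ i x, r₀ i x ∈ cyclesSubmodule C i := by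
    rintro (_ | i) x
    · exact mem_cyclesSubmodule_zero _
    · rw [mem_cyclesSubmodule_succ, hrs, map_sub, hs, sub_self]
  refine ⟨s, fun i => (r₀ i).codRestrict _ (hmem i), hs, ?_, hr₀, ?_, ?_⟩
  · rintro (_ | i) z
    · rfl
    · refine Subtype.ext ?_
      change r₀ (i + 1) z = z
      have h1 := mem_cyclesSubmodule_succ.1 z.2
      have h2 : (⟨C.d (i + 1) i (z : C.X (i + 1)), z, rfl⟩ :
          LinearMap.range (C.d (i + 1) i).hom) = 0 := Subtype.ext h1
      rw [hrs, h2, map_zero, sub_zero]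
  · intro i x
    change r₀ (i + 1) x + _ = x
    rw [hrs, sub_add_cancel]
  · intro i x
    refine Subtype.ext ?_
    change r₀ (i + 1) (s i x) = 0
    have h2 : (⟨C.d (i + 1) i (s i x), s i x, rfl⟩ :
          LinearMap.range (C.d (i + 1) i).hom) = x := Subtype.ext (hs i x)
    rw [hrs, h2, sub_self]

/-- Given presentations of its homology modules by diagonal matrices, a bounded free complex
becomes, after stabilization, a sum of complexes `Λ` and `Λ --a--> Λ`. -/
theorem exists_adapted_maps [Nontrivial Λ] {C : ChainComplex (ModuleCat.{0} Λ) ℕ}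
    (hC : IsFreeComplex C)
    {b q : ℕ → ℕ} {a : ∀ i, Fin (q i) → Λ} (ha : ∀ i s, a i s ∈ nonZeroDivisors Λ)
    (p : ∀ i, cyclesSubmodule C i →ₗ[Λ] (Fin (b i) → Λ) × (∀ s, Λ ⧸ Ideal.span {a i s}))
    (hp : ∀ i, Function.Surjective (p i))
    (hp0 : ∀ i z, p i z = 0 ↔ (z : C.X i) ∈ LinearMap.range (C.d (i + 1) i).hom) :
    ∃ x y : ℕ → ℕ, (∀ i, Subsingleton (C.X i) → x i = 0 ∧ y i = 0) ∧
      ∃ (X : ∀ i, StabilizeX C (fun i => x i + b i + q i) i →ₗ[Λ] (Fin (y i) ⊕ Fin (q i) → Λ))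
        (EX : ∀ i, (Fin (y i) ⊕ Fin (q i) → Λ) →ₗ[Λ] StabilizeX C (fun i => x i + b i + q i) i)
        (Y : ∀ i, StabilizeX C (fun i => x i + b i + q i) (i + 1) →ₗ[Λ]
          (Fin (y i) ⊕ Fin (q i) → Λ))
        (EY : ∀ i, (Fin (y i) ⊕ Fin (q i) → Λ) →ₗ[Λ]
          StabilizeX C (fun i => x i + b i + q i) (i + 1)),
        (∀ i v, X i (stabilizeD C _ i (EY i v)) = Sum.elim (1 : Fin (y i) → Λ) (a i) * v) ∧
        (∀ i v, X (i + 1) (EY i v) = 0) ∧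
        (∀ i c, stabilizeD C _ i c = EX i (Sum.elim (1 : Fin (y i) → Λ) (a i) * Y i c)) ∧
        ∀ i, Module.finrank Λ (StabilizeX C (fun i => x i + b i + q i) i) =
          y i + q i + b i + shift (fun i => y i + q i) i := by
  have hZ := isStablyFinFree_cycles hC ha p hp hp0
  have hB := fun i => (isStablyFinFree_boundaries (ha i) (hZ i) (p i) (hp i) (hp0 i)).projective
  obtain ⟨s, r, hs, hr, hr0, hrs, hrs0⟩ := exists_sections hB
  have hζ := fun i => exists_adapted_equiv (hZ i) (p i) (hp i)
  choose x y h0 ζ hζ using hζ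
  have hA : ∀ i t, Sum.elim (1 : Fin (y i) → Λ) (a i) t ∈ nonZeroDivisors Λ := by
    rintro i (t | t)
    · exact one_mem _
    · exact ha i t
  set A : ∀ i, Fin (y i) ⊕ Fin (q i) → Λ := fun i => Sum.elim (1 : Fin (y i) → Λ) (a i)
  have hζ' : ∀ i w, (w.1 : C.X i) ∈ LinearMap.range (C.d (i + 1) i).hom ↔
      (ζ i w).2 = 0 ∧ ∃ v, (ζ i w).1 = A i * v := fun i w => (hp0 i w.1).symm.trans (hζ i w)
  -- the elements of `Z × Q` with coordinates `(A v, 0)`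
  let g : ∀ i, (Fin (y i) ⊕ Fin (q i) → Λ) →ₗ[Λ]
      cyclesSubmodule C i × (Fin (x i + b i + q i) → Λ) := fun i =>
    (ζ i).symm.toLinearMap ∘ₗ LinearMap.inl Λ _ _
  have hg : ∀ i v, ζ i (g i v) = (v, 0) := fun i v => (ζ i).apply_symm_apply _
  let gA : ∀ i, (Fin (y i) ⊕ Fin (q i) → Λ) →ₗ[Λ]
      cyclesSubmodule C i × (Fin (x i + b i + q i) → Λ) := fun i =>
    g i ∘ₗ LinearMap.mulLeft Λ (A i)
  have hgA : ∀ i v, ζ i (gA i v) = (A i * v, 0) := fun i v => hg i _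
  have hgAmem : ∀ i v, ((gA i v).1 : C.X i) ∈ LinearMap.range (C.d (i + 1) i).hom := fun i v =>
    (hζ' i _).2 (by rw [hgA]; exact ⟨rfl, v, rfl⟩)
  let incl : ∀ i, cyclesSubmodule C i × (Fin (x i + b i + q i) → Λ) →ₗ[Λ]
      StabilizeX C (fun i => x i + b i + q i) i := fun i =>
    LinearMap.prodMap (cyclesSubmodule C i).subtype (LinearMap.inl Λ _ _)
  have hincl : ∀ i w, incl i w = ((w.1 : C.X i), w.2, 0) := fun i w => rfl
  let R1 : ∀ i, StabilizeX C (fun i => x i + b i + q i) i →ₗ[Λ]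
      cyclesSubmodule C i × (Fin (x i + b i + q i) → Λ) := fun i =>
    LinearMap.prodMap (r i) (LinearMap.fst Λ _ _)
  have hR1 : ∀ i c, R1 i c = (r i c.1, c.2.1) := fun i c => rfl
  -- boundaries of the stabilization
  let D1 : ∀ i, StabilizeX C (fun i => x i + b i + q i) (i + 1) →ₗ[Λ]
      cyclesSubmodule C i × (Fin (x i + b i + q i) → Λ) := fun i =>
    LinearMap.prodMap ((C.d (i + 1) i).hom.codRestrict _ (d_mem_cyclesSubmodule i))
      (LinearMap.snd Λ (Fin (x (i + 1) + b (i + 1) + q (i + 1)) → Λ)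
        (Fin (x i + b i + q i) → Λ))
  have hD1 : ∀ i c, incl i (D1 i c) = stabilizeD C _ i c := fun i c => rfl
  have hD1' : ∀ i c, D1 i c = (⟨C.d (i + 1) i c.1, d_mem_cyclesSubmodule i c.1⟩, c.2.2) :=
    fun i c => rfl
  have hD1A : ∀ i c, (ζ i (D1 i c)).2 = 0 ∧ ∃ v, (ζ i (D1 i c)).1 = A i * v := fun i c =>
    (hζ' i _).1 ⟨c.1, rfl⟩
  have hinj : ∀ i, Function.Injective (LinearMap.mulLeft Λ (A i)) := fun i v w h =>
    mul_left_injective_of_nonZeroDivisors (hA i) h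
  -- The coordinates of a boundary are divisible by `A i`; as its entries are non-zero-divisors, the
  -- quotient is unique and depends linearly on the chain.
  let Y : ∀ i, StabilizeX C (fun i => x i + b i + q i) (i + 1) →ₗ[Λ]
      (Fin (y i) ⊕ Fin (q i) → Λ) := fun i =>
    (LinearEquiv.ofInjective _ (hinj i)).symm.toLinearMap ∘ₗ
      (LinearMap.fst Λ _ _ ∘ₗ (ζ i).toLinearMap ∘ₗ D1 i).codRestrict _ fun c => by
        obtain ⟨v, hv⟩ := (hD1A i c).2
        exact ⟨v, hv.symm⟩
  have hY : ∀ i c, A i * Y i c = (ζ i (D1 i c)).1 := fun i c => by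
    exact congrArg Subtype.val ((LinearEquiv.ofInjective _ (hinj i)).apply_symm_apply _)
  have hgY : ∀ i c, gA i (Y i c) = D1 i c := fun i c => by
    refine (ζ i).injective ?_
    rw [hgA, hY]
    exact Prod.ext rfl (hD1A i c).1.symm
  -- A lift of the boundary with coordinates `A i * v`: through the section `s` in `C`, and directly
  -- in the added summand.
  let EY : ∀ i, (Fin (y i) ⊕ Fin (q i) → Λ) →ₗ[Λ]
      StabilizeX C (fun i => x i + b i + q i) (i + 1) := fun i =>
    (s i ∘ₗ ((cyclesSubmodule C i).subtype ∘ₗ LinearMap.fst Λ _ _ ∘ₗ gA i).codRestrict _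
      (hgAmem i)).prod (LinearMap.inr Λ _ _ ∘ₗ LinearMap.snd Λ _ _ ∘ₗ gA i)
  have hEY : ∀ i v, EY i v = (s i ⟨(gA i v).1, hgAmem i v⟩, 0, (gA i v).2) := fun i v => rfl
  have hDEY : ∀ i v, D1 i (EY i v) = gA i v := fun i v => by
    rw [hD1', hEY]
    exact Prod.ext (Subtype.ext (hs i _)) rfl
  have hR1incl : ∀ i w, R1 i (incl i w) = w := fun i w => by
    rw [hR1, hincl]
    exact Prod.ext (hr i _) rfl
  have hR1EY : ∀ i v, R1 (i + 1) (EY i v) = 0 := fun i v => by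
    rw [hR1, hEY]
    exact Prod.ext (hrs0 i _) rfl
  have hYEY : ∀ i v, Y i (EY i v) = v := fun i v => by
    refine mul_left_injective_of_nonZeroDivisors (hA i) ?_
    rw [hY, hDEY, hgA]
  refine ⟨x, y, fun i hi => h0 i inferInstance,
    fun i => LinearMap.fst Λ _ _ ∘ₗ (ζ i).toLinearMap ∘ₗ R1 i,
    fun i => incl i ∘ₗ g i, Y, EY, fun i v => ?_, fun i v => ?_, fun i c => ?_, fun i => ?_⟩
  · change (ζ i (R1 i (stabilizeD C _ i (EY i v)))).1 = A i * v
    rw [← hD1, hR1incl, hDEY, hgA]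
  · change (ζ (i + 1) (R1 (i + 1) (EY i v))).1 = 0
    rw [hR1EY, map_zero]
    rfl
  · change _ = incl i (gA i (Y i c))
    rw [hgY, hD1]
  · rcases i with _ | i
    · let e : StabilizeX C (fun i => x i + b i + q i) 0 ≃ₗ[Λ]
          cyclesSubmodule C 0 × (Fin (x 0 + b 0 + q 0) → Λ) :=
        LinearEquiv.ofLinearMap (R1 0) (incl 0) (LinearMap.ext fun w => hR1incl 0 w)
          (LinearMap.ext fun c => by
            change incl 0 (R1 0 c) = c
            rw [hincl, hR1]
            exact Prod.ext (hr0 _) (Prod.ext rfl (Subsingleton.elim (α := Fin 0 → Λ) _ _)))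
      rw [e.finrank_eq, (ζ 0).finrank_eq]
      simp [shift]
    · let e : StabilizeX C (fun i => x i + b i + q i) (i + 1) ≃ₗ[Λ]
          (cyclesSubmodule C (i + 1) × (Fin (x (i + 1) + b (i + 1) + q (i + 1)) → Λ)) ×
            (Fin (y i) ⊕ Fin (q i) → Λ) :=
        LinearEquiv.ofLinearMap ((R1 (i + 1)).prod (Y i)) ((incl (i + 1)).coprod (EY i))
          (LinearMap.ext fun w => by
            change (R1 (i + 1) (incl (i + 1) w.1 + EY i w.2),
              Y i (incl (i + 1) w.1 + EY i w.2)) = w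
            rw [map_add, map_add, hR1incl, hR1EY, hYEY, add_zero]
            have h1 : Y i (incl (i + 1) w.1) = 0 := by
              refine mul_left_injective_of_nonZeroDivisors (hA i) ?_
              have h2 : D1 i (incl (i + 1) w.1) = 0 :=
                Prod.ext (Subtype.ext (mem_cyclesSubmodule_succ.1 w.1.1.2)) rfl
              rw [hY, h2, map_zero, mul_zero]
              rfl
            rw [h1, zero_add])
          (LinearMap.ext fun c => by
            change incl (i + 1) (R1 (i + 1) c) + EY i (Y i c) = c
            rw [hincl, hR1, hEY]
            simp only [hgY]
            exact Prod.ext (hrs i c.1) (Prod.ext (add_zero _) (zero_add _)))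
      rw [e.finrank_eq,
        ((ζ (i + 1)).prodCongr (LinearEquiv.refl Λ (Fin (y i) ⊕ Fin (q i) → Λ))).finrank_eq]
      simp [shift, add_assoc]

end AdaptedMaps

/-! ### Lattices -/

section Lattice

variable {R : Type} [CommRing R]

theorem isUnit_algebraMap_X_pow (l : ℕ) :
    IsUnit (algebraMap R⟦X⟧ R⸨X⸩ (PowerSeries.X ^ l)) := by
  rw [map_pow]
  exact (IsLocalization.Away.algebraMap_isUnit _).pow l

/-- An `R[[t]]`-module embedded in an `R((t))`-module that it spans after inverting `t`. -/
structure IsLattice {M V : Type} [AddCommGroup M] [Module R⟦X⟧ M] [AddCommGroup V]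
    [Module R⸨X⸩ V] (incl : M →ₛₗ[algebraMap R⟦X⟧ R⸨X⸩] V) : Prop where
  injective : Function.Injective incl
  exists_mem : ∀ c : V, ∃ (l : ℕ) (x : M),
    incl x = (algebraMap R⟦X⟧ R⸨X⸩ (PowerSeries.X ^ l)) • c

variable {M V N W : Type} [AddCommGroup M] [Module R⟦X⟧ M] [AddCommGroup V] [Module R⸨X⸩ V]
  [AddCommGroup N] [Module R⟦X⟧ N] [AddCommGroup W] [Module R⸨X⸩ W]
  {incl : M →ₛₗ[algebraMap R⟦X⟧ R⸨X⸩] V} {incl' : N →ₛₗ[algebraMap R⟦X⟧ R⸨X⸩] W}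

theorem IsLattice.exists_mem_of_le (h : IsLattice incl) (c : V) :
    ∃ l₀ : ℕ, ∀ l, l₀ ≤ l → ∃ x : M,
      incl x = (algebraMap R⟦X⟧ R⸨X⸩ (PowerSeries.X ^ l)) • c := by
  obtain ⟨l₀, x, hx⟩ := h.exists_mem c
  refine ⟨l₀, fun l hl => ⟨(PowerSeries.X : R⟦X⟧) ^ (l - l₀) • x, ?_⟩⟩
  rw [map_smulₛₗ, hx, smul_smul, ← map_mul, ← pow_add, Nat.sub_add_cancel hl]

/-- Linear maps between the ambient modules lift to lattices after scaling. -/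
theorem IsLattice.exists_lift (h' : IsLattice incl') (incl : M →ₛₗ[algebraMap R⟦X⟧ R⸨X⸩] V)
    [Module.Free R⟦X⟧ M] [Module.Finite R⟦X⟧ M] (f : V →ₗ[R⸨X⸩] W) :
    ∃ l₀ : ℕ, ∀ l, l₀ ≤ l → ∃ F : M →ₗ[R⟦X⟧] N, ∀ x,
      incl' (F x) = (algebraMap R⟦X⟧ R⸨X⸩ (PowerSeries.X ^ l)) • f (incl x) := by
  let B := Module.Free.chooseBasis R⟦X⟧ M
  choose l₀ hl₀ using fun j => h'.exists_mem_of_le (f (incl (B j)))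
  refine ⟨Finset.univ.sup l₀, fun l hl => ?_⟩
  choose y hy using fun j => hl₀ j l ((Finset.le_sup (Finset.mem_univ j)).trans hl)
  refine ⟨B.constr R⟦X⟧ y, fun x => ?_⟩
  have hx : x ∈ Submodule.span R⟦X⟧ (Set.range B) := B.span_eq ▸ Submodule.mem_top
  induction hx using Submodule.span_induction with
  | zero => simp
  | add x x' _ _ hx hx' => rw [map_add, map_add, hx, hx', map_add, map_add, smul_add]
  | smul r x _ hx => rw [map_smul, map_smulₛₗ, hx, map_smulₛₗ, map_smul, smul_comm]
  | mem x hx =>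
    obtain ⟨j, rfl⟩ := hx
    rw [B.constr_basis, hy]

/-- Scaled lifts of `e` and of its inverse are injective maps between the lattices, which bound the
ranks both ways. -/
theorem IsLattice.finrank_eq [Nontrivial R] (h : IsLattice incl) (h' : IsLattice incl')
    [Module.Free R⟦X⟧ M] [Module.Finite R⟦X⟧ M] [Module.Free R⟦X⟧ N] [Module.Finite R⟦X⟧ N]
    (e : V ≃ₗ[R⸨X⸩] W) : Module.finrank R⟦X⟧ M = Module.finrank R⟦X⟧ N := by
  have key : ∀ {M V N W : Type} [AddCommGroup M] [Module R⟦X⟧ M] [AddCommGroup V]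
      [Module R⸨X⸩ V] [AddCommGroup N] [Module R⟦X⟧ N] [AddCommGroup W] [Module R⸨X⸩ W]
      {incl : M →ₛₗ[algebraMap R⟦X⟧ R⸨X⸩] V} {incl' : N →ₛₗ[algebraMap R⟦X⟧ R⸨X⸩] W}
      (_ : IsLattice incl) (_ : IsLattice incl')
      [Module.Free R⟦X⟧ M] [Module.Finite R⟦X⟧ M] [Module.Finite R⟦X⟧ N]
      (_ : V ≃ₗ[R⸨X⸩] W), Module.finrank R⟦X⟧ M ≤ Module.finrank R⟦X⟧ N := by
    intro M V N W _ _ _ _ _ _ _ _ incl incl' h h' _ _ _ e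
    obtain ⟨l, hl⟩ := h'.exists_lift incl e.toLinearMap
    obtain ⟨F, hF⟩ := hl l le_rfl
    refine LinearMap.finrank_le_finrank_of_injective (f := F) fun x x' hxx => h.injective ?_
    have h1 := hF x
    rw [hxx, hF x', (isUnit_algebraMap_X_pow l).smul_left_cancel] at h1
    exact (e.injective h1).symm
  exact le_antisymm (key h h' e) (key h' h e.symm)

/-- The standard lattice `R[[t]]^Ω` in `R((t))^Ω`. -/
def stdLattice (R : Type) [CommRing R] (Ω : Type) :
    (Ω → R⟦X⟧) →ₛₗ[algebraMap R⟦X⟧ R⸨X⸩] (Ω → R⸨X⸩) where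
  toFun v ω := algebraMap R⟦X⟧ R⸨X⸩ (v ω)
  map_add' v w := by ext1; simp
  map_smul' r v := by ext1; simp

theorem stdLattice_apply {Ω : Type} (v : Ω → R⟦X⟧) (ω : Ω) :
    stdLattice R Ω v ω = algebraMap R⟦X⟧ R⸨X⸩ (v ω) := rfl

theorem algebraMap_powerSeries_injective :
    Function.Injective (algebraMap R⟦X⟧ R⸨X⸩) :=
  HahnSeries.ofPowerSeries_injective

theorem isLattice_stdLattice (Ω : Type) [Fintype Ω] : IsLattice (stdLattice R Ω) where
  injective v w h := funext fun ω => algebraMap_powerSeries_injective (congrFun h ω)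
  exists_mem c := by
    have h1 : ∀ ω, ∃ (l : ℕ) (x : R⟦X⟧),
        algebraMap R⟦X⟧ R⸨X⸩ x = algebraMap R⟦X⟧ R⸨X⸩ (PowerSeries.X ^ l) * c ω := fun ω => by
      obtain ⟨l, x, hx⟩ := IsLocalization.Away.surj (PowerSeries.X : R⟦X⟧) (c ω)
      exact ⟨l, x, by rw [← hx, map_pow, mul_comm]⟩
    choose l x hx using h1
    refine ⟨Finset.univ.sup l, fun ω => (PowerSeries.X : R⟦X⟧) ^ (Finset.univ.sup l - l ω) * x ω,
      funext fun ω => ?_⟩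
    rw [stdLattice_apply, map_mul, hx, ← mul_assoc, ← map_mul, ← pow_add,
      Nat.sub_add_cancel (Finset.le_sup (Finset.mem_univ ω))]
    rfl

/-- The product of two lattices. -/
def prodIncl (incl : M →ₛₗ[algebraMap R⟦X⟧ R⸨X⸩] V) (incl' : N →ₛₗ[algebraMap R⟦X⟧ R⸨X⸩] W) :
    (M × N) →ₛₗ[algebraMap R⟦X⟧ R⸨X⸩] (V × W) where
  toFun x := (incl x.1, incl' x.2)
  map_add' x y := by simp
  map_smul' r x := by simp [map_smulₛₗ]

theorem IsLattice.prod (h : IsLattice incl) (h' : IsLattice incl') :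
    IsLattice (prodIncl incl incl') where
  injective x y hxy :=
    Prod.ext (h.injective (congrArg Prod.fst hxy)) (h'.injective (congrArg Prod.snd hxy))
  exists_mem c := by
    obtain ⟨l, hl⟩ := h.exists_mem_of_le c.1
    obtain ⟨l', hl'⟩ := h'.exists_mem_of_le c.2
    obtain ⟨x, hx⟩ := hl (max l l') (le_max_left _ _)
    obtain ⟨y, hy⟩ := hl' (max l l') (le_max_right _ _)
    exact ⟨_, (x, y), Prod.ext hx hy⟩

end Lattice

/-! ### Adapted complexes -/

section Adapted

variable {R : Type} [CommRing R]

/-- An `R[[t]]`-complex which after inverting `t` becomes a sum of complexes `R((t))` and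
`R((t)) --α--> R((t))`. The maps `toSource`, `toTarget` are the coordinates, and `ofSource`,
`ofTarget` the inclusions of the complexes of the second kind, scaled by powers of `t`. -/
structure Adapted (E : ChainComplex (ModuleCat.{0} R⟦X⟧) ℕ) (Ω : ℕ → Type)
    (α : ∀ i, Ω i → R⟦X⟧) where
  /-- the exponents of the scaling -/
  m : ℕ → ℕ
  toTarget : ∀ i, E.X i →ₗ[R⟦X⟧] (Ω i → R⟦X⟧)
  ofTarget : ∀ i, (Ω i → R⟦X⟧) →ₗ[R⟦X⟧] E.X i
  toSource : ∀ i, E.X (i + 1) →ₗ[R⟦X⟧] (Ω i → R⟦X⟧)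
  ofSource : ∀ i, (Ω i → R⟦X⟧) →ₗ[R⟦X⟧] E.X (i + 1)
  toTarget_d_ofSource : ∀ i v,
    toTarget i (E.d (i + 1) i (ofSource i v)) = (PowerSeries.X : R⟦X⟧) ^ m i • (α i * v)
  toTarget_ofSource : ∀ i v, toTarget (i + 1) (ofSource i v) = 0
  ofTarget_toSource : ∀ i c,
    ofTarget i (α i * toSource i c) = (PowerSeries.X : R⟦X⟧) ^ m i • E.d (i + 1) i c

/-- Denominators in the four families of coordinate maps are cleared by powers of `t`. -/
theorem nonempty_adapted_of_isLattice {E : ChainComplex (ModuleCat.{0} R⟦X⟧) ℕ}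
    (hE : IsFreeComplex E) {V : ℕ → Type} [∀ i, AddCommGroup (V i)] [∀ i, Module R⸨X⸩ (V i)]
    {incl : ∀ i, E.X i →ₛₗ[algebraMap R⟦X⟧ R⸨X⸩] V i} (h : ∀ i, IsLattice (incl i))
    {d : ∀ i, V (i + 1) →ₗ[R⸨X⸩] V i}
    (hd : ∀ i x, incl i (E.d (i + 1) i x) = d i (incl (i + 1) x))
    {Ω : ℕ → Type} [∀ i, Fintype (Ω i)] (α : ∀ i, Ω i → R⟦X⟧)
    (x : ∀ i, V i →ₗ[R⸨X⸩] (Ω i → R⸨X⸩)) (ex : ∀ i, (Ω i → R⸨X⸩) →ₗ[R⸨X⸩] V i)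
    (y : ∀ i, V (i + 1) →ₗ[R⸨X⸩] (Ω i → R⸨X⸩)) (ey : ∀ i, (Ω i → R⸨X⸩) →ₗ[R⸨X⸩] V (i + 1))
    (h₁ : ∀ i v, x i (d i (ey i v)) = stdLattice R (Ω i) (α i) * v)
    (h₂ : ∀ i v, x (i + 1) (ey i v) = 0)
    (h₃ : ∀ i c, d i c = ex i (stdLattice R (Ω i) (α i) * y i c)) :
    Nonempty (Adapted E Ω α) := by
  have := hE.free
  have := hE.finite
  choose lx hx using fun i => (isLattice_stdLattice (R := R) (Ω i)).exists_lift (incl i) (x i)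
  choose lex hex using fun i => (h i).exists_lift (stdLattice R (Ω i)) (ex i)
  choose ly hy using fun i =>
    (isLattice_stdLattice (R := R) (Ω i)).exists_lift (incl (i + 1)) (y i)
  choose ley hey using fun i => (h (i + 1)).exists_lift (stdLattice R (Ω i)) (ey i)
  choose x' hx' using fun i => hx i (lx i) le_rfl
  -- The exponents are padded so that the composites `x d ey` and `ex α y` are scaled by the same
  -- power of `t`; a single `m i` then serves both identities.
  choose ex' hex' using fun i => hex i (lex i + lx i + ley i) (by omega)
  choose y' hy' using fun i => hy i (ly i) le_rfl
  choose ey' hey' using fun i => hey i (lex i + ly i + ley i) (by omega)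
  have hmul : ∀ i (v w : Ω i → R⟦X⟧),
      stdLattice R (Ω i) (v * w) = stdLattice R (Ω i) v * stdLattice R (Ω i) w := fun i v w => by
    ext1 ω
    simp [stdLattice_apply]
  refine ⟨⟨fun i => lex i + lx i + ley i + ly i, x', ex', y', ey', fun i v => ?_, fun i v => ?_,
    fun i c => ?_⟩⟩
  · apply (isLattice_stdLattice (R := R) (Ω i)).injective
    rw [hx', hd, hey', map_smul, map_smul, h₁, map_smulₛₗ, hmul, smul_smul, ← map_mul, ← pow_add,
      show lx i + (lex i + ly i + ley i) = lex i + lx i + ley i + ly i by omega]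
  · apply (isLattice_stdLattice (R := R) (Ω (i + 1))).injective
    rw [hx', hey', map_smul, h₂, smul_zero, smul_zero, map_zero]
  · apply (h i).injective
    rw [hex', hmul, hy', map_smulₛₗ, hd, h₃, mul_smul_comm, map_smul, smul_smul, ← map_mul,
      ← pow_add]

end Adapted

/-! ### Complexes of principal type -/

section PrincipalType

variable {n : ℕ}

theorem augmentation_single {A : Type} [CommRing A] (g : Fin n → ℤ) (c : ℤ) :
    augmentation n A (AddMonoidAlgebra.single g c) = c := by
  simp [augmentation, AddMonoidAlgebra.lift_single]

/-- Leading coefficients multiply in `𝓛`, so that of `z` is a unit `c g` of `R`, and augmentation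
shows that `c = ± 1`. Hence the non-monic `a_s` are non-units and their cyclic modules are non-zero,
which forces `q i = 0` wherever `C` vanishes. -/
theorem isMonic_of_isUnit {z : LaurentPolynomial (GroupRing n)} (hs : IsSpecial z)
    (hu : IsUnit (toLaurentSeries z)) : IsMonic z := by
  obtain ⟨y, hy⟩ := hu.exists_right_inv
  have hz : toLaurentSeries z ≠ 0 := hu.ne_zero
  obtain ⟨g, c, hc⟩ := hs (toLaurentSeries z).order
  have h1 := congrArg HahnSeries.leadingCoeff hy
  rw [HahnSeries.leadingCoeff_mul, HahnSeries.leadingCoeff_one, HahnSeries.leadingCoeff_eq,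
    coeff_toLaurentSeries, hc] at h1
  have h2 := congrArg (augmentation n ℤ) h1
  rw [map_mul, map_one, augmentation_single] at h2
  refine ⟨(toLaurentSeries z).order, g, fun j hj => ?_, ?_⟩
  · rw [← coeff_toLaurentSeries]
    exact HahnSeries.coeff_eq_zero_of_lt_order hj
  · rw [hc]
    rcases Int.eq_one_or_neg_one_of_mul_eq_one h2 with h | h <;> simp at h <;> simp [h]

theorem exists_cycles_to_sum {Λ : Type} [CommRing Λ] {C : ChainComplex (ModuleCat.{0} Λ) ℕ}
    {i b q : ℕ} {a a' : Fin q → Λ} (h : ∀ s, Ideal.span {a s} = Ideal.span {a' s})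
    (e : C.homology i ≃ₗ[Λ] (Fin b → Λ) × (∀ s, Λ ⧸ Ideal.span {a s})) :
    ∃ p : cyclesSubmodule C i →ₗ[Λ] (Fin b → Λ) × (∀ s, Λ ⧸ Ideal.span {a' s}),
      Function.Surjective p ∧
      ∀ z, p z = 0 ↔ (z : C.X i) ∈ LinearMap.range (C.d (i + 1) i).hom :=
  exists_cycles_to_homology (e.trans ((LinearEquiv.refl Λ _).prodCongr
    (LinearEquiv.piCongrRight fun s => Submodule.quotEquivOfEq _ _ (h s))))

theorem eq_zero_of_subsingleton_cycles {Λ : Type} [CommRing Λ] [Nontrivial Λ]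
    {C : ChainComplex (ModuleCat.{0} Λ) ℕ} {i b q : ℕ} {a : Fin q → Λ}
    (ha : ∀ s, ¬ IsUnit (a s)) (hi : Subsingleton (C.X i))
    (p : cyclesSubmodule C i →ₗ[Λ] (Fin b → Λ) × (∀ s, Λ ⧸ Ideal.span {a s}))
    (hp : Function.Surjective p) : b = 0 ∧ q = 0 := by
  have h2 := hp.subsingleton
  constructor
  · by_contra hb
    have h3 : (fun _ => 1 : Fin b → Λ) = 0 := congrArg Prod.fst (Subsingleton.elim
      ((fun _ => 1, 0) : (Fin b → Λ) × (∀ s, Λ ⧸ Ideal.span {a s})) 0)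
    exact one_ne_zero (congrFun h3 ⟨0, Nat.pos_of_ne_zero hb⟩)
  · by_contra hq
    have h3 : (fun s => (Ideal.span {a s}).mkQ 1) = 0 := congrArg Prod.snd (Subsingleton.elim
      ((0, fun s => (Ideal.span {a s}).mkQ 1) : (Fin b → Λ) × (∀ s, Λ ⧸ Ideal.span {a s})) 0)
    have h4 := (Submodule.Quotient.mk_eq_zero _).1 (congrFun h3 ⟨0, Nat.pos_of_ne_zero hq⟩)
    exact ha _ (isUnit_of_dvd_one (Ideal.mem_span_singleton.1 h4))

variable {n : ℕ} {C : ChainComplex (ModuleCat.{0} (LaurentRing n)) ℕ}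

theorem PrincipalType.exists_cycles (P : PrincipalType C) (i : ℕ) :
    ∃ p : cyclesSubmodule C i →ₗ[LaurentRing n] (Fin (P.b i) → LaurentRing n) ×
        (∀ s, LaurentRing n ⧸ Ideal.span {algebraMap (GroupRing n)⟦X⟧ (LaurentRing n)
          (toPowerSeries (P.a i s))}),
      Function.Surjective p ∧
      ∀ z, p z = 0 ↔ (z : C.X i) ∈ LinearMap.range (C.d (i + 1) i).hom :=
  exists_cycles_to_sum (fun s => (span_toPowerSeries (P.a i s)).symm) (P.iso i)

end PrincipalType

/-! ### Adapted complexes from basic subcomplexes -/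

section Adapted

theorem isFreeComplex_stabilize {R : Type} [CommRing R] {D : ChainComplex (ModuleCat.{0} R) ℕ}
    (hD : IsFreeComplex D) {f : ℕ → ℕ} {N : ℕ} (hN : ∀ i, N < i → Limits.IsZero (D.X i))
    (hf : ∀ i, N < i → f i = 0) :
    IsFreeComplex (stabilize D f) ∧ ∀ i, N + 1 < i → Limits.IsZero ((stabilize D f).X i) := by
  have h1 : ∀ i, N + 1 < i → Limits.IsZero ((stabilize D f).X i) := by
    rintro (_ | i) hi
    · omega
    have h2 : Subsingleton (D.X (i + 1)) := ModuleCat.subsingleton_of_isZero (hN _ (by omega))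
    have h3 : IsEmpty (Fin (f (i + 1))) := by rw [hf _ (by omega)]; infer_instance
    have h4 : IsEmpty (Fin (shift f (i + 1))) := by
      rw [show shift f (i + 1) = f i from rfl, hf _ (by omega)]; infer_instance
    have h5 : Subsingleton (StabilizeX D f (i + 1)) := inferInstance
    exact ModuleCat.isZero_of_subsingleton (ModuleCat.of R (StabilizeX D f (i + 1)))
  refine ⟨⟨fun i => ?_, fun i => ?_, N + 1, h1⟩, h1⟩
  · have := hD.free i
    have h2 : Module.Free R (StabilizeX D f i) := inferInstance
    exact h2
  · have := hD.finite i
    have h2 : Module.Finite R (StabilizeX D f i) := inferInstance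
    exact h2

theorem BasicSubcomplex.isLattice {R : Type} [CommRing R]
    {C : ChainComplex (ModuleCat.{0} R⸨X⸩) ℕ} (D : BasicSubcomplex C) (i : ℕ) :
    IsLattice (D.incl i) :=
  ⟨D.incl_injective i, D.exists_mem i⟩

variable {n : ℕ} {C : ChainComplex (ModuleCat.{0} (LaurentRing n)) ℕ}

/-- The elements defining the differentials of the summands `𝓛` and `𝓛 --a--> 𝓛` of a complex
of principal type. -/
def PrincipalType.alpha (P : PrincipalType C) (y : ℕ → ℕ) (i : ℕ) :
    Fin (y i) ⊕ Fin (P.q i) → (GroupRing n)⟦X⟧ :=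
  Sum.elim 1 fun s => toPowerSeries (P.a i s)

/-- `E` is the stabilization of `D` by the summands used for `C`. It is a lattice in the
stabilization of `C`, so it has the same ranks and receives the diagonal coordinates up to scaling.
-/
theorem PrincipalType.exists_adapted (P : PrincipalType C) (hC : IsFreeComplex C) {N : ℕ}
    (hN : ∀ i, N < i → Limits.IsZero (C.X i)) (D : BasicSubcomplex C) :
    (∀ i, N < i → P.b i = 0 ∧ P.q i = 0) ∧
    ∃ (y : ℕ → ℕ) (E : ChainComplex (ModuleCat.{0} (GroupRing n)⟦X⟧) ℕ),
      IsFreeComplex E ∧ (∀ i, N + 1 < i → Limits.IsZero (E.X i)) ∧ (∀ i, N < i → y i = 0) ∧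
      Nonempty (HomotopyEquiv E D.complex) ∧
      (∀ i, Module.finrank (GroupRing n)⟦X⟧ (E.X i) =
        y i + P.q i + P.b i + shift (fun i => y i + P.q i) i) ∧
      Nonempty (Adapted E (fun i => Fin (y i) ⊕ Fin (P.q i)) (P.alpha y)) := by
  have hu : ∀ i s, ¬ IsUnit (algebraMap (GroupRing n)⟦X⟧ (LaurentRing n)
      (toPowerSeries (P.a i s))) := fun i s h => by
    rw [← Ideal.span_singleton_eq_top, span_toPowerSeries, Ideal.span_singleton_eq_top] at h
    exact P.not_monic i s (isMonic_of_isUnit (P.special i s) h)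
  choose p hp hp0 using P.exists_cycles
  have hsub : ∀ i, N < i → Subsingleton (C.X i) := fun i hi =>
    ModuleCat.subsingleton_of_isZero (hN i hi)
  have hbq : ∀ i, N < i → P.b i = 0 ∧ P.q i = 0 := fun i hi =>
    eq_zero_of_subsingleton_cycles (hu i) (hsub i hi) (p i) (hp i)
  refine ⟨hbq, ?_⟩
  have ha : ∀ i s, algebraMap (GroupRing n)⟦X⟧ (LaurentRing n) (toPowerSeries (P.a i s)) ∈
      nonZeroDivisors (LaurentRing n) := fun i s => by
    refine mem_nonZeroDivisors_of_ne_zero fun h => toPowerSeries_ne_zero (P.ne_zero i s) ?_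
    exact algebraMap_powerSeries_injective (h.trans (map_zero _).symm)
  obtain ⟨x, y, hxy, X, EX, Y, EY, h₁, h₂, h₃, hr⟩ := exists_adapted_maps hC ha p hp hp0
  let f : ℕ → ℕ := fun i => x i + P.b i + P.q i
  have hf0 : ∀ i, N < i → f i = 0 := fun i hi => by
    simp only [f, (hxy i (hsub i hi)).1, hbq i hi, add_zero]
  have hDN : ∀ i, N < i → Limits.IsZero (D.complex.X i) := fun i hi => by
    have := hsub i hi
    have := (D.incl_injective i).subsingleton
    exact ModuleCat.isZero_of_subsingleton _
  obtain ⟨hE, hEN⟩ := isFreeComplex_stabilize D.isFree hDN hf0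
  have hlat : ∀ i, IsLattice (prodIncl (D.incl i) (prodIncl (stdLattice (GroupRing n) (Fin (f i)))
      (stdLattice (GroupRing n) (Fin (shift f i))))) := fun i =>
    (D.isLattice i).prod ((isLattice_stdLattice _).prod (isLattice_stdLattice _))
  have hα : ∀ i, stdLattice (GroupRing n) _ (P.alpha y i) =
      (Sum.elim 1 fun s => algebraMap (GroupRing n)⟦X⟧ (LaurentRing n) (toPowerSeries (P.a i s)) :
        Fin (y i) ⊕ Fin (P.q i) → LaurentRing n) := fun i => by
    funext ω
    rcases ω with ω | ω
    · exact map_one (algebraMap (GroupRing n)⟦X⟧ (LaurentRing n))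
    · rfl
  refine ⟨y, stabilize D.complex f, hE, hEN, fun i hi => (hxy i (hsub i hi)).2,
    ⟨stabilizeHomotopyEquiv D.complex f⟩, fun i => ?_, ?_⟩
  · have := D.isFree.free i
    have := D.isFree.finite i
    have := hC.free i
    have := hC.finite i
    let e := (Module.finBasis (LaurentRing n) (StabilizeX C f i)).equivFun
    refine ((hlat i).finrank_eq (isLattice_stdLattice _) e).trans ?_
    rw [Module.finrank_fin_fun]
    exact hr i
  · exact nonempty_adapted_of_isLattice hE (V := fun i => StabilizeX C f i) hlat
      (d := fun i => stabilizeD C f i) (fun i c => by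
        rw [stabilize_d]
        refine Prod.ext (D.incl_comm _ _ _) (Prod.ext rfl (map_zero _))) (P.alpha y) X EX Y EY
      (fun i v => by rw [hα]; exact h₁ i v) h₂ (fun i c => by rw [hα]; exact h₃ i c)

end Adapted

/-! ### Truncations -/

section Trunc

variable {R : Type} [CommRing R] (k : ℕ)

section Module

variable {M : Type} [AddCommGroup M] [Module R⟦X⟧ M] [Module R M] [IsScalarTower R R⟦X⟧ M]

/-- The projection `M → M / t^k M`. -/
def truncMk (M : Type) [AddCommGroup M] [Module R⟦X⟧ M] [Module R M] [IsScalarTower R R⟦X⟧ M] :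
    M →ₗ[R] (truncFunctor R k).obj (ModuleCat.of R⟦X⟧ M) where
  toFun x := Submodule.Quotient.mk (p := (Ideal.span {(PowerSeries.X : R⟦X⟧) ^ k} • ⊤ :
    Submodule R⟦X⟧ M)) x
  map_add' x y := rfl
  map_smul' r x := by
    rw [algebra_compatible_smul R⟦X⟧ r x]
    rfl

variable {k}

theorem truncMk_surjective : Function.Surjective (truncMk (R := R) k M) :=
  Submodule.Quotient.mk_surjective _

theorem truncMk_X_pow_smul (x : M) : truncMk (R := R) k M ((PowerSeries.X : R⟦X⟧) ^ k • x) = 0 :=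
  (Submodule.Quotient.mk_eq_zero _).2
    (Submodule.smul_mem_smul (Ideal.mem_span_singleton_self _) Submodule.mem_top)

theorem exists_eq_smul_of_truncMk_eq_zero {x : M} (hx : truncMk (R := R) k M x = 0) :
    ∃ y, x = (PowerSeries.X : R⟦X⟧) ^ k • y := by
  have h1 : x ∈ (Ideal.span {(PowerSeries.X : R⟦X⟧) ^ k} • ⊤ : Submodule R⟦X⟧ M) :=
    (Submodule.Quotient.mk_eq_zero _).1 hx
  rw [Submodule.ideal_span_singleton_smul] at h1
  obtain ⟨y, -, hy⟩ := h1
  exact ⟨y, hy.symm⟩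

/-- Coordinates on `M / t^k M` for a free module `M`. -/
def truncEquiv {Ω : Type} (k : ℕ) (e : M ≃ₗ[R⟦X⟧] (Ω → R⟦X⟧)) :
    (truncFunctor R k).obj (ModuleCat.of R⟦X⟧ M) ≃ₗ[R] (Ω → Fin k → R) := by
  let c : M →ₗ[R] (Ω → Fin k → R) :=
    LinearMap.pi fun ω => LinearMap.pi fun j => PowerSeries.coeff (j : ℕ) ∘ₗ
      LinearMap.proj ω ∘ₗ (e.toLinearMap.restrictScalars R)
  have hc : ∀ x, c x = 0 ↔ truncMk (R := R) k M x = 0 := fun x => by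
    constructor
    · intro h
      have h1 : ∀ ω, ∃ y, e x ω = (PowerSeries.X : R⟦X⟧) ^ k * y := fun ω =>
        PowerSeries.X_pow_dvd_iff.2 fun j hj => congrFun (congrFun h ω) ⟨j, hj⟩
      choose y hy using h1
      have h2 : x = (PowerSeries.X : R⟦X⟧) ^ k • e.symm y := by
        rw [← map_smul, LinearEquiv.eq_symm_apply]
        exact funext hy
      rw [h2, truncMk_X_pow_smul]
    · intro h
      obtain ⟨y, rfl⟩ := exists_eq_smul_of_truncMk_eq_zero h
      funext ω j
      change PowerSeries.coeff (j : ℕ) (e _ ω) = 0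
      rw [map_smul]
      exact PowerSeries.coeff_X_pow_mul' _ _ _ |>.trans (if_neg (by omega))
  have hsurj : Function.Surjective c := fun v => ⟨e.symm fun ω => ofCoeffs R k (v ω), by
    funext ω j
    change PowerSeries.coeff (j : ℕ) (e (e.symm _) ω) = _
    rw [LinearEquiv.apply_symm_apply, coeff_ofCoeffs]⟩
  have hker : LinearMap.ker (truncMk (R := R) k M) = LinearMap.ker c := by
    ext x
    exact (hc x).symm
  exact ((truncMk (R := R) k M).quotKerEquivOfSurjective truncMk_surjective).symm ≪≫ₗ
    Submodule.quotEquivOfEq _ _ hker ≪≫ₗ c.quotKerEquivOfSurjective hsurj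

theorem truncEquiv_truncMk {Ω : Type} (e : M ≃ₗ[R⟦X⟧] (Ω → R⟦X⟧)) (x : M) (ω : Ω) (j : Fin k) :
    truncEquiv k e (truncMk k M x) ω j = PowerSeries.coeff (j : ℕ) (e x ω) := by
  have h : ((truncMk (R := R) k M).quotKerEquivOfSurjective truncMk_surjective).symm
      (truncMk k M x) = Submodule.Quotient.mk x := by
    rw [LinearEquiv.symm_apply_eq]
    rfl
  simp only [truncEquiv, LinearEquiv.trans_apply]
  rw [h]
  rfl

theorem exists_truncMk_section [Nontrivial R] [Module.Free R⟦X⟧ M] [Module.Finite R⟦X⟧ M] :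
    ∃ s : (truncFunctor R k).obj (ModuleCat.of R⟦X⟧ M) →ₗ[R] M,
      ∀ x, truncMk k M (s x) = x := by
  let e := (Module.finBasis R⟦X⟧ M).equivFun
  refine ⟨(e.symm.toLinearMap.restrictScalars R) ∘ₗ
    (LinearMap.pi fun ω => ofCoeffs R k ∘ₗ LinearMap.proj ω) ∘ₗ
      (truncEquiv k e).toLinearMap, fun x => (truncEquiv k e).injective ?_⟩
  funext ω j
  rw [truncEquiv_truncMk]
  change PowerSeries.coeff (j : ℕ) (e (e.symm _) ω) = _
  rw [LinearEquiv.apply_symm_apply]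
  change PowerSeries.coeff (j : ℕ) (ofCoeffs R k (truncEquiv k e x ω)) = _
  rw [coeff_ofCoeffs]

/-- The division of a power series by `t^m`. -/
def divXPow (R : Type) [CommRing R] (m : ℕ) : R⟦X⟧ →ₗ[R] R⟦X⟧ where
  toFun f := PowerSeries.mk fun j => PowerSeries.coeff (j + m) f
  map_add' f g := by ext; simp
  map_smul' r f := by ext; simp

theorem coeff_divXPow (m j : ℕ) (f : R⟦X⟧) :
    PowerSeries.coeff j (divXPow R m f) = PowerSeries.coeff (j + m) f :=
  PowerSeries.coeff_mk j fun j => PowerSeries.coeff (j + m) f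

/-- Dropping the first `m` coefficients is only `R`-linear, but it is defined everywhere. It undoes
the scaling by `t^m` in `Adapted`. -/
theorem exists_divXPow [Nontrivial R] [Module.Free R⟦X⟧ M] [Module.Finite R⟦X⟧ M] (m : ℕ) :
    ∃ D : M →ₗ[R] M, ∀ x, D ((PowerSeries.X : R⟦X⟧) ^ m • x) = x := by
  let e := (Module.finBasis R⟦X⟧ M).equivFun
  refine ⟨(e.symm.toLinearMap.restrictScalars R) ∘ₗ
    (LinearMap.pi fun ω => divXPow R m ∘ₗ LinearMap.proj ω) ∘ₗ
      (e.toLinearMap.restrictScalars R), fun x => ?_⟩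
  refine e.symm_apply_eq.2 (funext fun ω => ?_)
  change divXPow R m (e _ ω) = e x ω
  rw [map_smul]
  ext j
  rw [coeff_divXPow]
  exact PowerSeries.coeff_X_pow_mul (e x ω) m j

end Module

theorem finrank_trunc [Nontrivial R] (M : ModuleCat.{0} R⟦X⟧) [Module.Free R⟦X⟧ M]
    [Module.Finite R⟦X⟧ M] : Module.Free R ((truncFunctor R k).obj M) ∧
    Module.Finite R ((truncFunctor R k).obj M) ∧
    Module.finrank R ((truncFunctor R k).obj M) = k * Module.finrank R⟦X⟧ M := by
  let : Module R M := Module.compHom M (algebraMap R R⟦X⟧)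
  have : IsScalarTower R R⟦X⟧ M := IsScalarTower.of_algebraMap_smul fun _ _ => rfl
  let e : (truncFunctor R k).obj M ≃ₗ[R] (Fin (Module.finrank R⟦X⟧ M) → Fin k → R) :=
    truncEquiv k (Module.finBasis R⟦X⟧ M).equivFun
  refine ⟨Module.Free.of_equiv e.symm, Module.Finite.equiv e.symm, ?_⟩
  rw [e.finrank_eq, Module.finrank_pi_fintype]
  simp [mul_comm]

variable {E E' : ChainComplex (ModuleCat.{0} R⟦X⟧) ℕ}

theorem isZero_truncComplex {i : ℕ} (h : Limits.IsZero (E.X i)) :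
    Limits.IsZero ((truncComplex E k).X i) :=
  (truncFunctor R k).map_isZero h

theorem isFreeComplex_truncComplex [Nontrivial R] (hE : IsFreeComplex E) :
    IsFreeComplex (truncComplex E k) where
  free i := by
    have := hE.free i
    have := hE.finite i
    exact (finrank_trunc k (E.X i)).1
  finite i := by
    have := hE.free i
    have := hE.finite i
    exact (finrank_trunc k (E.X i)).2.1
  bounded := by
    obtain ⟨N, hN⟩ := hE.bounded
    exact ⟨N, fun i hi => isZero_truncComplex k (hN i hi)⟩

theorem finrank_truncComplex [Nontrivial R] (hE : IsFreeComplex E) (i : ℕ) :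
    Module.finrank R ((truncComplex E k).X i) = k * Module.finrank R⟦X⟧ (E.X i) := by
  have := hE.free i
  have := hE.finite i
  exact (finrank_trunc k (E.X i)).2.2

theorem mu_eq_of_homotopyEquiv (e : HomotopyEquiv E E') : mu E k = mu E' k :=
  morseNumber_eq_of_homotopyEquiv ((truncFunctor R k).mapHomotopyEquiv e)

end Trunc

/-! ### Upper bounds for the Morse numbers of truncations -/

section Upper

variable {R : Type} [CommRing R] {E : ChainComplex (ModuleCat.{0} R⟦X⟧) ℕ} {Ω : ℕ → Type}
  {α : ∀ i, Ω i → R⟦X⟧}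

/-- `ι` inserts polynomials of degree less than `K` into the chosen sources. `θ` reads `K + l`
coefficients of the matching targets, starting at `t^(m i)` because of the scaling, and applies the
left inverse of multiplication by `α`. The bound on `k` ensures that these coefficients survive
truncation. -/
theorem Adapted.exists_cancel (S : Adapted E Ω α) {g : ℕ → ℕ} {j : ∀ i, Fin (g i) → Ω i}
    (hj : ∀ i, Function.Injective (j i)) {l : ℕ}
    (hl : ∀ i r, Ideal.span ((fun s => PowerSeries.coeff s (α i (j i r))) '' Set.Iic l) = ⊤)
    {K k : ℕ} (hk : ∀ i, 0 < g i → S.m i + (K + l) ≤ k) :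
    ∃ (θ : ∀ i, (truncComplex E k).X i →ₗ[R] (Fin (g i * K) → R))
      (ι : ∀ i, (Fin (g i * K) → R) →ₗ[R] (truncComplex E k).X (i + 1)),
      (∀ i x, θ i ((truncComplex E k).d (i + 1) i (ι i x)) = x) ∧
      ∀ i x, θ (i + 1) (ι i x) = 0 := by
  let : ∀ i, Module R (E.X i) := fun i => Module.compHom _ (algebraMap R R⟦X⟧)
  have : ∀ i, IsScalarTower R R⟦X⟧ (E.X i) := fun i =>
    IsScalarTower.of_algebraMap_smul fun _ _ => rfl
  choose ρ hρ using fun i r => exists_leftInverse_mul_coeffs (α i (j i r)) (hl i r) K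
  let e : ∀ i, (Fin (g i * K) → R) ≃ₗ[R] (Fin (g i) → Fin K → R) := fun i =>
    (LinearEquiv.funCongrLeft R R finProdFinEquiv) ≪≫ₗ LinearEquiv.curry R R _ _
  let w : ∀ i, (Fin (g i * K) → R) →ₗ[R] (Ω i → R⟦X⟧) := fun i =>
    ((Function.ExtendByZero.linearMap R⟦X⟧ (j i)).restrictScalars R) ∘ₗ
      (LinearMap.pi fun r => ofCoeffs R K ∘ₗ LinearMap.proj r) ∘ₗ (e i).toLinearMap
  have hw : ∀ i x r, w i x (j i r) = ofCoeffs R K (e i x r) := fun i x r =>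
    (hj i).extend_apply _ _ _
  let ι : ∀ i, (Fin (g i * K) → R) →ₗ[R] (truncComplex E k).X (i + 1) := fun i =>
    truncMk k (E.X (i + 1)) ∘ₗ ((S.ofSource i).restrictScalars R) ∘ₗ w i
  let c : ∀ i, (truncComplex E k).X i →ₗ[R] (Ω i → Fin k → R) := fun i =>
    (truncEquiv k (LinearEquiv.refl R⟦X⟧ (Ω i → R⟦X⟧))).toLinearMap ∘ₗ
      ((truncFunctor R k).map (ModuleCat.ofHom (S.toTarget i))).hom
  have hc : ∀ i x ω s, c i (truncMk k (E.X i) x) ω s =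
      PowerSeries.coeff (s : ℕ) (S.toTarget i x ω) := fun i x ω s =>
    truncEquiv_truncMk (LinearEquiv.refl R⟦X⟧ (Ω i → R⟦X⟧)) (S.toTarget i x) ω s
  let θ : ∀ i, (truncComplex E k).X i →ₗ[R] (Fin (g i * K) → R) := fun i =>
    (e i).symm.toLinearMap ∘ₗ (LinearMap.pi fun r => ρ i r ∘ₗ
      LinearMap.funLeft R R
        (fun s : Fin (K + l) => (⟨S.m i + s, by have := hk i r.pos; omega⟩ : Fin k)) ∘ₗ
        LinearMap.proj (j i r)) ∘ₗ c i
  have hθ : ∀ i x, θ i (truncMk k (E.X i) x) = (e i).symm fun r => ρ i r fun s : Fin (K + l) =>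
      PowerSeries.coeff (S.m i + (s : ℕ)) (S.toTarget i x (j i r)) := fun i x => by
    refine congrArg (e i).symm (funext fun r => congrArg (ρ i r) (funext fun s => ?_))
    exact hc i x _ _
  refine ⟨θ, ι, fun i x => ?_, fun i x => ?_⟩
  · change θ i (truncMk k (E.X i) (E.d (i + 1) i (S.ofSource i (w i x)))) = x
    rw [hθ, S.toTarget_d_ofSource, LinearEquiv.symm_apply_eq]
    funext r
    refine Eq.trans (congrArg (ρ i r) (funext fun s => ?_)) (hρ i r (e i x r))
    rw [add_comm, ← hw, mul_comm (w i x (j i r))]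
    exact PowerSeries.coeff_X_pow_mul (α i (j i r) * w i x (j i r)) (S.m i) s
  · change θ (i + 1) (truncMk k (E.X (i + 1)) (S.ofSource i (w i x))) = 0
    rw [hθ, S.toTarget_ofSource, LinearEquiv.symm_apply_eq, map_zero]
    funext r
    refine Eq.trans (congrArg _ (funext fun s => ?_)) (map_zero (ρ (i + 1) r))
    exact map_zero _

/-- Condition `hu` says that each term is either untouched or keeps rank at least `d`, so that Bass
cancellation makes it free. -/
theorem morseNumber_add_le [Nontrivial R] {B : ChainComplex (ModuleCat.{0} R) ℕ}
    (hB : IsFreeComplex B) {N : ℕ} (hN : ∀ i, N < i → Limits.IsZero (B.X i)) {u : ℕ → ℕ}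
    {θ : ∀ i, B.X i →ₗ[R] (Fin (u i) → R)} {ι : ∀ i, (Fin (u i) → R) →ₗ[R] B.X (i + 1)}
    (h₁ : ∀ i x, θ i (B.d (i + 1) i (ι i x)) = x) (h₂ : ∀ i x, θ (i + 1) (ι i x) = 0) {d : ℕ}
    (hR : HasStableRange R d)
    (hu : ∀ i, u i + shift u i = 0 ∨ d + (u i + shift u i) ≤ Module.finrank R (B.X i)) :
    morseNumber B + ∑ i ∈ Finset.range (N + 1), (u i + shift u i) ≤
      ∑ i ∈ Finset.range (N + 1), Module.finrank R (B.X i) := by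
  have hG : ∀ i, ∃ r, r + (u i + shift u i) = Module.finrank R (B.X i) ∧
      Nonempty ((cancelComplex B θ).X i ≃ₗ[R] (Fin r → R)) := fun i => by
    have := hB.free i
    have := hB.finite i
    obtain ⟨e₁⟩ := nonempty_cancelSubmodule_prod_equiv h₁ h₂ i
    let e₂ := (Module.finBasis R (B.X i)).equivFun
    rcases hu i with h0 | h0
    · have : IsEmpty (Fin (u i + shift u i)) := by rw [h0]; infer_instance
      exact ⟨_, by rw [h0, add_zero], ⟨LinearEquiv.prodUnique.symm ≪≫ₗ e₁ ≪≫ₗ e₂⟩⟩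
    · obtain ⟨r, hr⟩ := Nat.exists_eq_add_of_le h0
      rw [show Module.finrank R (B.X i) = (d + r) + (u i + shift u i) by omega] at e₂ ⊢
      exact ⟨d + r, rfl, hR.nonempty_equiv_of_prod_fin (by omega) _ (e₁ ≪≫ₗ e₂)⟩
  choose r hr e using hG
  have hGN : ∀ i, N < i → Limits.IsZero ((cancelComplex B θ).X i) := fun i hi => by
    have h3 : Subsingleton (B.X i) := ModuleCat.subsingleton_of_isZero (hN i hi)
    have h4 : Subsingleton (cancelSubmodule B θ i) := inferInstance
    exact ModuleCat.isZero_of_subsingleton (ModuleCat.of R (cancelSubmodule B θ i))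
  have hGf : IsFreeComplex (cancelComplex B θ) :=
    ⟨fun i => Module.Free.of_equiv (e i).some.symm, fun i => Module.Finite.equiv (e i).some.symm,
      N, hGN⟩
  obtain ⟨h⟩ := nonempty_homotopyEquiv_cancelComplex h₁ h₂
  have h5 := morseNumber_le hGf h
  rw [finsum_finrank_eq hGN] at h5
  have h6 : ∀ i, Module.finrank R ((cancelComplex B θ).X i) = r i := fun i => by
    rw [(e i).some.finrank_eq, Module.finrank_fin_fun]
  simp only [h6] at h5
  refine (Nat.add_le_add_right h5 _).trans_eq ?_
  rw [← Finset.sum_add_distrib]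
  exact Finset.sum_congr rfl fun i _ => hr i

theorem Adapted.mu_add_le [Nontrivial R] (S : Adapted E Ω α) (hE : IsFreeComplex E) {N : ℕ}
    (hN : ∀ i, N < i → Limits.IsZero (E.X i)) {g : ℕ → ℕ} {j : ∀ i, Fin (g i) → Ω i}
    (hj : ∀ i, Function.Injective (j i)) {l : ℕ}
    (hl : ∀ i r, Ideal.span ((fun s => PowerSeries.coeff s (α i (j i r))) '' Set.Iic l) = ⊤)
    (hg : ∀ i, g i + shift g i ≤ Module.finrank R⟦X⟧ (E.X i))
    {d m : ℕ} (hR : HasStableRange R d) (hm : ∀ i, 0 < g i → S.m i ≤ m) (hd : d ≤ m + l) (K : ℕ) :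
    mu E (m + l + K) + (∑ i ∈ Finset.range (N + 1), (g i + shift g i)) * K ≤
      (m + l + K) * ∑ i ∈ Finset.range (N + 1), Module.finrank R⟦X⟧ (E.X i) := by
  obtain ⟨θ, ι, h₁, h₂⟩ := S.exists_cancel hj hl (K := K) (k := m + l + K) fun i hi => by
    have := hm i hi
    omega
  have hshift : ∀ i, g i * K + shift (fun i => g i * K) i = (g i + shift g i) * K := by
    rintro (_ | i)
    · simp [shift]
    · exact (add_mul _ _ _).symm
  have h3 := morseNumber_add_le (isFreeComplex_truncComplex _ hE)
    (fun i hi => isZero_truncComplex _ (hN i hi)) h₁ h₂ hR fun i => by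
      rw [finrank_truncComplex _ hE, hshift]
      rcases Nat.eq_zero_or_pos (g i + shift g i) with h0 | h0
      · exact Or.inl (by rw [h0, zero_mul])
      -- Of the `m + l + K` generators for each unit of rank at most `K` are cancelled, so at least
      -- `m + l ≥ d` remain.
      · right
        calc d + (g i + shift g i) * K
            ≤ (m + l) * (g i + shift g i) + (g i + shift g i) * K :=
              Nat.add_le_add_right (hd.trans (Nat.le_mul_of_pos_right _ h0)) _
          _ = (m + l + K) * (g i + shift g i) := by ring
          _ ≤ _ := Nat.mul_le_mul_left _ (hg i)
  simp only [finrank_truncComplex _ hE, hshift] at h3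
  rwa [← Finset.sum_mul, ← Finset.mul_sum] at h3

end Upper

/-! ### Lower bounds for the Morse numbers of truncations -/

section Lower

variable {R : Type} [CommRing R]

theorem diffRank_le_of_factor (F : Type) [Field F] [Algebra R F] [Nontrivial R]
    {B : ChainComplex (ModuleCat.{0} R) ℕ} {i : ℕ} {V : Type} [AddCommGroup V] [Module R V]
    [Module.Free R V] [Module.Finite R V] {P : V →ₗ[R] B.X i} {Q : B.X (i + 1) →ₗ[R] V}
    {T : B.X (i + 1) →ₗ[R] B.X i} {p : R} (hp : algebraMap R F p = 0)
    (h : ∀ x, B.d (i + 1) i x = P (Q x) + p • T x) : diffRank F B i ≤ Module.finrank R V := by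
  have h1 : (B.d (i + 1) i).hom = P ∘ₗ Q + p • T := LinearMap.ext h
  have h2 : (B.d (i + 1) i).hom.baseChange F = P.baseChange F ∘ₗ Q.baseChange F := by
    rw [h1, LinearMap.baseChange_add, LinearMap.baseChange_smul, LinearMap.baseChange_comp,
      algebra_compatible_smul F, hp, zero_smul, add_zero]
  rw [diffRank, h2, LinearMap.range_comp]
  refine (Submodule.finrank_map_le _ _).trans ?_
  refine (Submodule.finrank_le _).trans_eq ?_
  exact Module.finrank_baseChange

theorem exists_eq_ofCoeffs_add (f : R⟦X⟧) (K : ℕ) :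
    ∃ h, f = ofCoeffs R K (fun s => PowerSeries.coeff (s : ℕ) f) +
      (PowerSeries.X : R⟦X⟧) ^ K * h := by
  obtain ⟨h, hh⟩ : (PowerSeries.X : R⟦X⟧) ^ K ∣
      f - ofCoeffs R K (fun s => PowerSeries.coeff (s : ℕ) f) := by
    refine PowerSeries.X_pow_dvd_iff.2 fun s hs => ?_
    rw [map_sub, coeff_ofCoeffs _ (⟨s, hs⟩ : Fin K), sub_self]
  exact ⟨h, by rw [← hh, add_sub_cancel]⟩

variable {E : ChainComplex (ModuleCat.{0} R⟦X⟧) ℕ} {Ω : ℕ → Type} {α : ∀ i, Ω i → R⟦X⟧}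

/-- Up to the factor `t^m`, the differential is `ofTarget ∘ α ∘ toSource`. The entries of `α`
outside the range of `j` vanish modulo `p`. The others pass through `R[[t]]^g`, of which only the
first `m + k` coefficients matter in `E / t^k E`. -/
theorem Adapted.diffRank_le [Nontrivial R] (S : Adapted E Ω α) (hE : IsFreeComplex E) (k : ℕ)
    {i g : ℕ} {j : Fin g → Ω i} (hj : Function.Injective j) (F : Type) [Field F] [Algebra R F]
    {p : R} (hp : algebraMap R F p = 0)
    (hα : ∀ ω, ω ∉ Set.range j → algebraMap R R⟦X⟧ p ∣ α i ω) :
    diffRank F (truncComplex E k) i ≤ g * (S.m i + k) := by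
  classical
  let : ∀ i, Module R (E.X i) := fun i => Module.compHom _ (algebraMap R R⟦X⟧)
  have : ∀ i, IsScalarTower R R⟦X⟧ (E.X i) := fun i =>
    IsScalarTower.of_algebraMap_smul fun _ _ => rfl
  have := hE.free
  have := hE.finite
  obtain ⟨s, hs⟩ := exists_truncMk_section (R := R) (k := k) (M := E.X (i + 1))
  obtain ⟨D, hD⟩ := exists_divXPow (R := R) (M := E.X i) (S.m i)
  have hβ : ∀ ω, ∃ β, ω ∉ Set.range j → α i ω = p • β := fun ω => by
    by_cases hω : ω ∈ Set.range j
    · exact ⟨0, fun h => absurd hω h⟩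
    · obtain ⟨β, h⟩ := hα ω hω
      exact ⟨β, fun _ => by rw [h, Algebra.smul_def]⟩
  choose β hβ using hβ
  let β' : Ω i → R⟦X⟧ := fun ω => if ω ∈ Set.range j then 0 else β ω
  let pad : (Fin g → R⟦X⟧) →ₗ[R⟦X⟧] (Ω i → R⟦X⟧) :=
    LinearMap.mulLeft R⟦X⟧ (α i) ∘ₗ Function.ExtendByZero.linearMap R⟦X⟧ j
  have hsplit : ∀ v, α i * v = pad (v ∘ j) + p • (β' * v) := fun v => by
    funext ω
    by_cases hω : ω ∈ Set.range j
    · have h0 : β' ω = 0 := if_pos hω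
      obtain ⟨r, rfl⟩ := hω
      have h1 : pad (v ∘ j) (j r) = α i (j r) * v (j r) :=
        congrArg (α i (j r) * ·) (hj.extend_apply _ _ _)
      rw [Pi.add_apply, h1, Pi.smul_apply, Pi.mul_apply, Pi.mul_apply, h0, zero_mul, smul_zero,
        add_zero]
    · have h0 : β' ω = β ω := if_neg hω
      have h1 : pad (v ∘ j) ω = α i ω * 0 :=
        congrArg (α i ω * ·) (Function.extend_apply' _ _ _ hω)
      rw [Pi.add_apply, h1, Pi.smul_apply, Pi.mul_apply, Pi.mul_apply, h0, mul_zero, zero_add,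
        hβ ω hω, smul_mul_assoc]
  let G : (Fin g → R⟦X⟧) →ₗ[R] (truncComplex E k).X i :=
    truncMk k (E.X i) ∘ₗ D ∘ₗ ((S.ofTarget i ∘ₗ pad).restrictScalars R)
  -- `D` removes the factor `t^m`, and truncation kills the remaining `t^k`.
  have hG : ∀ v, G ((PowerSeries.X : R⟦X⟧) ^ (S.m i + k) • v) = 0 := fun v => by
    change truncMk k (E.X i) (D ((S.ofTarget i ∘ₗ pad) (_ • v))) = 0
    rw [map_smul, pow_add, mul_smul, hD, truncMk_X_pow_smul]
  let P : (Fin g → Fin (S.m i + k) → R) →ₗ[R] (truncComplex E k).X i :=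
    G ∘ₗ LinearMap.pi fun r => ofCoeffs R (S.m i + k) ∘ₗ LinearMap.proj r
  let c : (Fin g → R⟦X⟧) →ₗ[R] (Fin g → Fin (S.m i + k) → R) :=
    LinearMap.pi fun r => LinearMap.pi fun s => PowerSeries.coeff (s : ℕ) ∘ₗ LinearMap.proj r
  have hPc : ∀ v, P (c v) = G v := fun v => by
    choose h hh using fun r => exists_eq_ofCoeffs_add (v r) (S.m i + k)
    have h1 : v = (fun r => ofCoeffs R (S.m i + k) (c v r)) +
        (PowerSeries.X : R⟦X⟧) ^ (S.m i + k) • h := funext hh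
    conv_rhs => rw [h1, map_add, hG, add_zero]
    rfl
  let Q : (truncComplex E k).X (i + 1) →ₗ[R] (Fin g → Fin (S.m i + k) → R) :=
    c ∘ₗ (LinearMap.funLeft R R⟦X⟧ j) ∘ₗ ((S.toSource i).restrictScalars R) ∘ₗ s
  let T : (truncComplex E k).X (i + 1) →ₗ[R] (truncComplex E k).X i :=
    truncMk k (E.X i) ∘ₗ D ∘ₗ ((S.ofTarget i ∘ₗ LinearMap.mulLeft R⟦X⟧ β' ∘ₗ
      S.toSource i).restrictScalars R) ∘ₗ s
  refine (diffRank_le_of_factor F (P := P) (Q := Q) (T := T) hp fun x => ?_).trans_eq ?_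
  · have h1 : P (Q x) = G (S.toSource i (s x) ∘ j) := hPc _
    have h2 : (truncComplex E k).d (i + 1) i x =
        truncMk k (E.X i) (D (S.ofTarget i (α i * S.toSource i (s x)))) := by
      rw [S.ofTarget_toSource, hD]
      exact congrArg ((truncComplex E k).d (i + 1) i) (hs x).symm
    rw [h1, h2, hsplit, map_add, map_add, map_add, LinearMap.map_smul_of_tower, map_smul, map_smul]
    rfl
  · rw [Module.finrank_pi_fintype]
    simp

end Lower

/-! ### Linear growth of the Morse numbers of truncations -/

section Bounds

theorem sum_shift (f : ℕ → ℕ) (N : ℕ) :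
    ∑ i ∈ Finset.range (N + 1), shift f i = ∑ i ∈ Finset.range N, f i := by
  rw [Finset.sum_range_succ']
  rfl

variable {R : Type} [CommRing R] [Nontrivial R] {E : ChainComplex (ModuleCat.{0} R⟦X⟧) ℕ}
  {Ω : ℕ → Type} {α : ∀ i, Ω i → R⟦X⟧}

theorem mu_le (hE : IsFreeComplex E) {N : ℕ} (hN : ∀ i, N < i → Limits.IsZero (E.X i)) (k : ℕ) :
    mu E k ≤ k * ∑ i ∈ Finset.range (N + 1), Module.finrank R⟦X⟧ (E.X i) := by
  have h1 := morseNumber_le (isFreeComplex_truncComplex k hE) (HomotopyEquiv.refl _)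
  rw [finsum_finrank_eq fun i hi => isZero_truncComplex k (hN i hi)] at h1
  simp only [finrank_truncComplex _ hE, ← Finset.mul_sum] at h1
  exact h1

/-- The upper bound comes from cancelling pairs, the lower one from ranks modulo the `p i`. Sums run
to degree `N + 1` because stabilization adds one degree. -/
theorem Adapted.exists_mu_bounds (S : Adapted E Ω α) (hE : IsFreeComplex E) {N : ℕ}
    (hN : ∀ i, N + 1 < i → Limits.IsZero (E.X i)) {g : ℕ → ℕ} {j : ∀ i, Fin (g i) → Ω i}
    (hj : ∀ i, Function.Injective (j i)) (hg₀ : ∀ i, N < i → g i = 0)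
    (hl : ∀ i r, ∃ l,
      Ideal.span ((fun s => PowerSeries.coeff s (α i (j i r))) '' Set.Iic l) = ⊤)
    (hg : ∀ i, g i + shift g i ≤ Module.finrank R⟦X⟧ (E.X i))
    {d : ℕ} (hR : HasStableRange R d) {F : ℕ → Type} [∀ i, Field (F i)] [∀ i, Algebra R (F i)]
    {p : ℕ → R} (hp : ∀ i, algebraMap R (F i) (p i) = 0)
    (hα : ∀ i ω, ω ∉ Set.range (j i) → algebraMap R R⟦X⟧ (p i) ∣ α i ω) :
    ∃ c, ∀ k,
      mu E k + 2 * (∑ i ∈ Finset.range (N + 1), g i) * k ≤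
        k * ∑ i ∈ Finset.range (N + 2), Module.finrank R⟦X⟧ (E.X i) + c ∧
      k * ∑ i ∈ Finset.range (N + 2), Module.finrank R⟦X⟧ (E.X i) ≤
        mu E k + 2 * (∑ i ∈ Finset.range (N + 1), g i) * k + c := by
  choose l' hl' using hl
  let l := (Finset.range (N + 1)).sup fun i => Finset.univ.sup (l' i)
  -- The summand `d` ensures that enough generators survive for Bass cancellation.
  let m := d + (Finset.range (N + 1)).sup S.m
  have hi : ∀ i, 0 < g i → i ∈ Finset.range (N + 1) := fun i h => by
    by_contra h'
    rw [Finset.mem_range] at h'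
    exact h.ne' (hg₀ i (by omega))
  have hlr : ∀ i r, Ideal.span ((fun s => PowerSeries.coeff s (α i (j i r))) '' Set.Iic l) = ⊤ :=
    fun i r => top_le_iff.1 ((hl' i r).ge.trans (Ideal.span_mono (Set.image_mono
      (Set.Iic_subset_Iic.2 ((Finset.le_sup (Finset.mem_univ r)).trans
        (Finset.le_sup (f := fun i => Finset.univ.sup (l' i)) (hi i r.pos)))))))
  have hm : ∀ i, 0 < g i → S.m i ≤ m := fun i h =>
    (Finset.le_sup (f := S.m) (hi i h)).trans (Nat.le_add_left _ _)
  set γ := ∑ i ∈ Finset.range (N + 1), g i with hγ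
  set r := ∑ i ∈ Finset.range (N + 2), Module.finrank R⟦X⟧ (E.X i)
  have hγ2 : ∑ i ∈ Finset.range (N + 2), (g i + shift g i) = 2 * γ := by
    rw [Finset.sum_add_distrib, sum_shift, Finset.sum_range_succ, hg₀ (N + 1) (by omega), ← hγ]
    ring
  have hup : ∀ K, mu E (m + l + K) + 2 * γ * K ≤ (m + l + K) * r := fun K => by
    rw [← hγ2]
    exact S.mu_add_le hE hN hj hlr hg hR hm (by omega) K
  let c₁ := 2 * γ * (m + l)
  let c₂ := 2 * ∑ i ∈ Finset.range (N + 1), g i * S.m i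
  refine ⟨c₁ + c₂, fun k => ⟨?_, ?_⟩⟩
  · rcases le_total (m + l) k with h | h
    · obtain ⟨K, rfl⟩ := Nat.exists_eq_add_of_le h
      have := hup K
      rw [mul_add (2 * γ)]
      omega
    -- For `k ≤ m + l` nothing need be cancelled: the constant absorbs `2 * γ * k`.
    · have h1 : mu E k ≤ k * r := mu_le hE hN k
      have h2 := Nat.mul_le_mul_left (2 * γ) h
      omega
  · have h1 := sum_finrank_le_morseNumber F (isFreeComplex_truncComplex k hE)
      fun i hi => isZero_truncComplex k (hN i hi)
    simp only [finrank_truncComplex _ hE, ← Finset.mul_sum] at h1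
    change k * r ≤ mu E k + _ at h1
    have h2 : ∑ i ∈ Finset.range (N + 1), diffRank (F i) (truncComplex E k) i ≤
        ∑ i ∈ Finset.range (N + 1), g i * (S.m i + k) :=
      Finset.sum_le_sum fun i _ => S.diffRank_le hE k (hj i) (F i) (hp i) (hα i)
    simp only [mul_add, Finset.sum_add_distrib, ← Finset.sum_mul, ← hγ] at h2
    rw [mul_assoc]
    omega

variable {n : ℕ} {C : ChainComplex (ModuleCat.{0} (LaurentRing n)) ℕ}

/-- A prime dividing the first polynomial that is not numerically prime divides all later ones along
the chain, so one residue field per degree detects all of them. -/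
theorem PrincipalType.exists_prime (P : PrincipalType C) (i : ℕ) :
    ∃ p : ℕ, p.Prime ∧ ∀ s, ¬ IsNumericallyPrime (P.a i s) →
      algebraMap (GroupRing n) (GroupRing n)⟦X⟧ p ∣ toPowerSeries (P.a i s) := by
  classical
  by_cases h : ∃ s, ¬ IsNumericallyPrime (P.a i s)
  · obtain ⟨s, hs⟩ := h
    obtain ⟨s₀, hs₀, hmin⟩ := Finset.exists_min_image
      (Finset.univ.filter fun s => ¬ IsNumericallyPrime (P.a i s)) id ⟨s, by simpa using hs⟩
    rw [Finset.mem_filter] at hs₀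
    obtain ⟨p, hp, hdvd⟩ := exists_prime_dvd_of_not_isNumericallyPrime hs₀.2
    refine ⟨p, hp, fun s hs => ?_⟩
    have h1 := intCast_dvd_toPowerSeries
      (hdvd.trans (P.dvd i s₀ s (hmin s (by simpa using hs))))
    simpa using h1
  -- With nothing to divide, any prime will do.
  · exact ⟨2, Nat.prime_two, fun s hs => absurd ⟨s, hs⟩ h⟩

theorem PrincipalType.exists_mu_bounds (P : PrincipalType C) (hC : IsFreeComplex C) {N : ℕ}
    (hN : ∀ i, N < i → Limits.IsZero (C.X i)) (D : BasicSubcomplex C) :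
    ∃ c, ∀ k,
      mu D.complex k ≤ k * (∑ i ∈ Finset.range (N + 1), P.b i +
        2 * ∑ i ∈ Finset.range (N + 1), P.kappa i) + c ∧
      k * (∑ i ∈ Finset.range (N + 1), P.b i + 2 * ∑ i ∈ Finset.range (N + 1), P.kappa i) ≤
        mu D.complex k + c := by
  classical
  obtain ⟨hbq, y, E, hE, hEN, hy, ⟨e⟩, hr, ⟨S⟩⟩ := P.exists_adapted hC hN D
  obtain ⟨d, hR⟩ := exists_hasStableRange n
  choose p hp hdvd using P.exists_prime
  have : ∀ i, Fact (p i).Prime := fun i => ⟨hp i⟩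
  let : ∀ i, Algebra (GroupRing n) (ZMod (p i)) := fun i => (augmentation n (ZMod (p i))).toAlgebra
  -- The good summands: multiplier `1` or numerically prime. The `κ_i` others vanish modulo `p i`.
  let G : ℕ → Type := fun i => Fin (y i) ⊕ {s : Fin (P.q i) // IsNumericallyPrime (P.a i s)}
  let g : ℕ → ℕ := fun i => Fintype.card (G i)
  let j : ∀ i, Fin (g i) → Fin (y i) ⊕ Fin (P.q i) := fun i =>
    Sum.map id Subtype.val ∘ (Fintype.equivFin (G i)).symm
  have hj : ∀ i, Function.Injective (j i) := fun i =>
    (Function.injective_id.sumMap Subtype.val_injective).comp (Equiv.injective _)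
  have hgk : ∀ i, g i + P.kappa i = y i + P.q i := fun i => by
    have h1 := Fintype.card_subtype_compl fun s => IsNumericallyPrime (P.a i s)
    have h2 := Fintype.card_subtype_le fun s => IsNumericallyPrime (P.a i s)
    rw [Fintype.card_fin] at h1 h2
    change Fintype.card (Fin (y i) ⊕ _) + _ = _
    rw [PrincipalType.kappa, Nat.card_eq_fintype_card, Fintype.card_sum, Fintype.card_fin, h1]
    omega
  have hg₀ : ∀ i, N < i → g i = 0 := fun i hi => by
    have := hgk i
    rw [hy i hi, (hbq i hi).2] at this
    omega
  have hl : ∀ i r, ∃ l, Ideal.span ((fun s => PowerSeries.coeff s (P.alpha y i (j i r))) ''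
      Set.Iic l) = ⊤ := fun i r => by
    obtain ⟨ω, rfl⟩ := (Fintype.equivFin (G i)).surjective r
    simp only [j, Function.comp_apply, Equiv.symm_apply_apply]
    rcases ω with ω | ⟨s, hs⟩
    · refine ⟨0, (Ideal.eq_top_iff_one _).2 (Ideal.subset_span ⟨0, Set.mem_Iic.2 le_rfl, ?_⟩)⟩
      exact PowerSeries.coeff_zero_one
    · exact exists_span_coeff_toPowerSeries (P.special i s) hs
  have hg : ∀ i, g i + shift g i ≤ Module.finrank (GroupRing n)⟦X⟧ (E.X i) := fun i => by
    rw [hr]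
    have h1 : ∀ i, g i ≤ y i + P.q i := fun i => by have := hgk i; omega
    have h2 : shift g i ≤ shift (fun i => y i + P.q i) i := by
      rcases i with _ | i
      · exact le_rfl
      · exact h1 i
    have := h1 i
    omega
  have hpF : ∀ i, algebraMap (GroupRing n) (ZMod (p i)) (p i) = 0 := fun i => by
    rw [map_natCast]
    exact ZMod.natCast_self _
  have hα : ∀ i ω, ω ∉ Set.range (j i) →
      algebraMap (GroupRing n) (GroupRing n)⟦X⟧ (p i) ∣ P.alpha y i ω := fun i ω hω => by
    rcases ω with ω | s
    · exact absurd ⟨Fintype.equivFin (G i) (Sum.inl ω), by simp [j]⟩ hω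
    · exact hdvd i s fun hs => hω ⟨Fintype.equivFin (G i) (Sum.inr ⟨s, hs⟩), by simp [j]⟩
  obtain ⟨c, hc⟩ := S.exists_mu_bounds hE hEN hj hg₀ hl hg hR (F := fun i => ZMod (p i)) hpF hα
  refine ⟨c, fun k => ?_⟩
  obtain ⟨h1, h2⟩ := hc k
  rw [mu_eq_of_homotopyEquiv k e] at h1 h2
  -- Each two-term summand contributes to two adjacent degrees, whence the factors `2`.
  have hs : ∑ i ∈ Finset.range (N + 2), Module.finrank (GroupRing n)⟦X⟧ (E.X i) =
      ∑ i ∈ Finset.range (N + 1), P.b i + 2 * ∑ i ∈ Finset.range (N + 1), P.kappa i +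
        2 * ∑ i ∈ Finset.range (N + 1), g i := by
    simp only [hr]
    rw [Finset.sum_add_distrib, sum_shift, Finset.sum_range_succ, hy _ N.lt_succ_self,
      (hbq _ N.lt_succ_self).1, (hbq _ N.lt_succ_self).2]
    simp only [← hgk, Finset.sum_add_distrib]
    ring
  rw [hs, mul_add, mul_comm k (2 * ∑ i ∈ Finset.range (N + 1), g i)] at h1 h2
  constructor <;> omega

end Bounds

/-! ### Existence of basic subcomplexes -/

section Existence

variable {R : Type} [CommRing R]

theorem IsLattice.comp_equiv {M V W : Type} [AddCommGroup M] [Module R⟦X⟧ M] [AddCommGroup V]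
    [Module R⸨X⸩ V] [AddCommGroup W] [Module R⸨X⸩ W]
    {incl : M →ₛₗ[algebraMap R⟦X⟧ R⸨X⸩] V} (h : IsLattice incl) (e : V ≃ₗ[R⸨X⸩] W) :
    IsLattice (e.toLinearMap.comp incl) where
  injective := e.injective.comp h.injective
  exists_mem c := by
    obtain ⟨l, x, hx⟩ := h.exists_mem (e.symm c)
    refine ⟨l, x, ?_⟩
    change e (incl x) = _
    rw [hx, map_smul, e.apply_symm_apply]

/-- Standard lattices are rescaled degree by degree, so that the differential maps each one into the
one below. -/
theorem nonempty_basicSubcomplex [Nontrivial R] {C : ChainComplex (ModuleCat.{0} R⸨X⸩) ℕ}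
    (hC : IsFreeComplex C) : Nonempty (BasicSubcomplex C) := by
  have := hC.free
  have := hC.finite
  have : Nontrivial R⸨X⸩ := algebraMap_powerSeries_injective.nontrivial
  let c : ℕ → ℕ := fun i => Module.finrank R⸨X⸩ (C.X i)
  let e : ∀ i, (Fin (c i) → R⸨X⸩) ≃ₗ[R⸨X⸩] C.X i := fun i =>
    (Module.finBasis R⸨X⸩ (C.X i)).equivFun.symm
  let incl₀ : ∀ i, (Fin (c i) → R⟦X⟧) →ₛₗ[algebraMap R⟦X⟧ R⸨X⸩] C.X i := fun i =>
    (e i).toLinearMap.comp (stdLattice R (Fin (c i)))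
  let incl : ∀ i, ℕ → ((Fin (c i) → R⟦X⟧) →ₛₗ[algebraMap R⟦X⟧ R⸨X⸩] C.X i) := fun i m =>
    (LinearEquiv.smulOfUnit (isUnit_algebraMap_X_pow (R := R) m).unit).toLinearMap.comp (incl₀ i)
  have hincl : ∀ i m x, incl i m x = algebraMap R⟦X⟧ R⸨X⸩ (PowerSeries.X ^ m) • incl₀ i x :=
    fun i m x => rfl
  have hlat : ∀ i m, IsLattice (incl i m) := fun i m =>
    ((isLattice_stdLattice _).comp_equiv (e i)).comp_equiv _
  have hlift : ∀ i m, ∃ (l : ℕ) (F : (Fin (c (i + 1)) → R⟦X⟧) →ₗ[R⟦X⟧] (Fin (c i) → R⟦X⟧)),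
      ∀ x, incl i m (F x) = C.d (i + 1) i (incl (i + 1) l x) := fun i m => by
    obtain ⟨l, hl⟩ := (hlat i m).exists_lift (incl₀ (i + 1)) (C.d (i + 1) i).hom
    obtain ⟨F, hF⟩ := hl l le_rfl
    refine ⟨l, F, fun x => ?_⟩
    rw [hF, hincl, map_smul]
  choose l F hF using hlift
  -- The exponent in degree `i + 1` is the one that `hlift` yields for the lattice already fixed in
  -- degree `i`.
  let m : ℕ → ℕ := fun i => Nat.rec 0 l i
  have hd : ∀ i x, incl i (m i) (F i (m i) x) = C.d (i + 1) i (incl (i + 1) (m (i + 1)) x) :=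
    fun i x => hF i (m i) x
  have hdd : ∀ i, ModuleCat.ofHom (F (i + 1) (m (i + 1))) ≫ ModuleCat.ofHom (F i (m i)) = 0 :=
    fun i => by
      ext1
      refine LinearMap.ext fun x => (hlat i (m i)).injective ?_
      change incl i (m i) (F i (m i) (F (i + 1) (m (i + 1)) x)) = incl i (m i) 0
      rw [hd]
      refine (congrArg (C.d (i + 1) i) (hd (i + 1) x)).trans ?_
      rw [d_d_apply, map_zero]
  let D : ChainComplex (ModuleCat.{0} R⟦X⟧) ℕ :=
    ChainComplex.of (fun i => ModuleCat.of R⟦X⟧ (Fin (c i) → R⟦X⟧))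
      (fun i => ModuleCat.ofHom (F i (m i))) hdd
  refine ⟨⟨D, ⟨fun i => ?_, fun i => ?_, ?_⟩, fun i => incl i (m i),
    fun i => (hlat i (m i)).injective, fun i j x => ?_, fun i => (hlat i (m i)).exists_mem⟩⟩
  · exact inferInstanceAs (Module.Free R⟦X⟧ (Fin (c i) → R⟦X⟧))
  · exact inferInstanceAs (Module.Finite R⟦X⟧ (Fin (c i) → R⟦X⟧))
  · obtain ⟨N, hN⟩ := hC.bounded
    refine ⟨N, fun i hi => ?_⟩
    have := ModuleCat.subsingleton_of_isZero (hN i hi)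
    have := (hlat i (m i)).injective.subsingleton
    exact ModuleCat.isZero_of_subsingleton (ModuleCat.of R⟦X⟧ (Fin (c i) → R⟦X⟧))
  · by_cases hij : j + 1 = i
    · subst hij
      have h1 : D.d (j + 1) j = ModuleCat.ofHom (F j (m j)) :=
        ChainComplex.of_d (fun i => ModuleCat.of R⟦X⟧ (Fin (c i) → R⟦X⟧))
          (fun i => ModuleCat.ofHom (F i (m i))) j
      rw [h1]
      exact hd j x
    · rw [D.shape _ _ hij, C.shape _ _ hij]
      exact map_zero (incl j (m j))

end Existence

/-! ### From bounded deviation to the limit -/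

theorem tendsto_div_of_abs_sub_le {u : ℕ → ℝ} {v c : ℝ} (h : ∀ k : ℕ, |u k - v * k| ≤ c) :
    Tendsto (fun k : ℕ => u k / k) atTop (𝓝 v) := by
  have h1 : Tendsto (fun k : ℕ => c / (k : ℝ)) atTop (𝓝 0) :=
    tendsto_const_div_atTop_nhds_zero_nat c
  rw [tendsto_iff_norm_sub_tendsto_zero]
  refine squeeze_zero' (Eventually.of_forall fun _ => norm_nonneg _) ?_ h1
  filter_upwards [eventually_gt_atTop 0] with k hk
  have hk' : (0 : ℝ) < k := Nat.cast_pos.2 hk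
  rw [Real.norm_eq_abs, show u k / k - v = (u k - v * k) / k by field_simp, abs_div,
    abs_of_pos hk']
  exact div_le_div_of_nonneg_right (h k) hk'.le

theorem PrincipalType.exists_abs_sub_le {n : ℕ}
    {C : ChainComplex (ModuleCat.{0} (LaurentRing n)) ℕ} (P : PrincipalType C)
    (hC : IsFreeComplex C) {N : ℕ} (hN : ∀ i, N < i → Limits.IsZero (C.X i))
    (D : BasicSubcomplex C) :
    ∃ c : ℝ, ∀ k : ℕ, |(mu D.complex k : ℝ) - ((∑ i ∈ Finset.range (N + 1), P.b i +
      2 * ∑ i ∈ Finset.range (N + 1), P.kappa i : ℕ) : ℝ) * k| ≤ c := by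
  obtain ⟨c, hc⟩ := P.exists_mu_bounds hC hN D
  refine ⟨c, fun k => ?_⟩
  obtain ⟨h1, h2⟩ := hc k
  have h1' := (Nat.cast_le (α := ℝ)).2 h1
  have h2' := (Nat.cast_le (α := ℝ)).2 h2
  rw [Nat.cast_add, Nat.cast_mul] at h1' h2'
  rw [abs_le]
  constructor <;> linarith

end MorseGrowth

end

theorem theorem2p3 (n : ℕ)
    (C : ChainComplex (ModuleCat.{0} (MorseGrowth.LaurentRing n)) ℕ)
    (hC : MorseGrowth.IsFreeComplex C) (P : MorseGrowth.PrincipalType C)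
    (N : ℕ) (hN : ∀ i, N < i → Limits.IsZero (C.X i)) :
    MorseGrowth.HasAsymptoticallyLinearGrowth C ∧
      MorseGrowth.HasSInvariant C
        (((∑ i ∈ Finset.range (N + 1), P.b i) +
          2 * ∑ i ∈ Finset.range (N + 1), P.kappa i : ℕ) : ℝ) := by
  obtain ⟨D₀⟩ := MorseGrowth.nonempty_basicSubcomplex hC
  refine ⟨⟨D₀, ?_⟩, ⟨D₀⟩, fun D => ?_⟩
  · obtain ⟨c, hc⟩ := P.exists_abs_sub_le hC hN D₀
    refine ⟨c, ((∑ i ∈ Finset.range (N + 1), P.b i +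
      2 * ∑ i ∈ Finset.range (N + 1), P.kappa i : ℕ) : ℝ), fun k => ?_⟩
    have := abs_le.1 (hc k)
    constructor <;> linarith
  · obtain ⟨c, hc⟩ := P.exists_abs_sub_le hC hN D
    exact MorseGrowth.tendsto_div_of_abs_sub_le hc
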